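/- \textbf{Lemma (Distance perturbation).} \emph{Model.} Let $U,T,R$ be finite sets (users, tags, resources), $n=|U|+|T|+|R|$, and let $k\ge 1$ be the number of communities. Let $0\le q<p\le 1$ and $P=\tilde P=(p-q)I+q\mathbf 1\mathbf 1^\top\in\mathbb R^{k\times k}$. The membership vectors $\pi_i$, $i\in U\cup T\cup R$, are i.i.d. from a distribution $f_\pi$ on the simplex $\Delta^{k-1}$ with $\mathbb E[\pi]=\frac1k\mathbf 1$; put $\Pi=(\pi_i)_i$. Given $\Pi$, for every triplet $(u,t,r)$ one draws coordinate basis vectors $z_{u\to\{t,r\}}\sim\mathrm{Multinomial}(\pi_u)$, $z_{t\to\{u,r\}}\sim\mathrm{Multinomial}(\pi_t)$, $z_{r\to\{u,t\}}\sim\mathrm{Multinomial}(\pi_r)$, all conditionally independent. Given $\Pi$ and all the $z$'s, one draws independent variables $\hat B_{r\to u;t}\sim\mathrm{Bernoulli}(z_{u\to\{t,r\}}^\top P z_{r\to\{u,t\}})$ and $\hat B_{r\to t;u}\sim\mathrm{Bernoulli}(z_{t\to\{u,r\}}^\top\tilde P z_{r\to\{u,t\}})$. Let $\hat G\in\{0,1\}^{|U||T|\times|R|}$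 have entries $\hat G(\{u,t\},r)=\hat B_{r\to u;t}\,\hat B_{r\to t;u}$, and let $G=\mathbb E[\hat G\mid\Pi]$. \emph{Projection.} Let $R=X\sqcup Y$ be a partition with $|Y|\ge k$, and let $\hat{\mathcal P}=M_kM_k^\top$, where the columns of $M_k$ are the top $k$ left singular vectors of $\hat G(\{U,T\},Y)$, taken from a singular value decomposition that is chosen as a function of $\hat G(\{U,T\},Y)$ only. \emph{Claim.} For all constants $c,\gamma>0$ there is a constant $C'>0$, depending only on $c$ and $\gamma$, such that the following holds. Suppose that $|U|,|T|\ge\gamma n$, that the probability $\rho$ that $\pi$ is a coordinate basis vector and the $k$-th singular value $\sigma_k(\mathbb E[\pi\pi^\top])$ are positive, and that \[\frac{(p-q)^2}{p}\ \ge\ c\,\frac{\sqrt k}{\sqrt{n\rho}\;\sigma_k(\mathbb E[\pi\pi^\top])}.\] Then for every $\delta\in(0,1)$, with probability at least $1-\delta$, for all $x\in X$, \[\bigl\|\hat{\mathcal P}\bigl(\hat G(\{U,T\},x)-G(\{U,T\},x)\bigr)\bigr\|_2\ \le\ \sqrt k\,p\,\Bigl(1+\frac{C'}{\sqrt k}\bigl(\log(n/\delta)\bigr)^4\Bigr)^{1/2}.\]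 -/

import Mathlib

open MeasureTheory ProbabilityTheory
open scoped Matrix

namespace MMSF

/-- The success/failure probabilities of a Bernoulli variable with parameter `a`. -/
def bernWeight (a : ℝ) (b : Bool) : ℝ := if b then a else 1 - a

/-- The mixed membership stochastic folksonomy model on a probability space `(Ω, μ)`, with user set
`U`, tag set `T`, resource set `R`, `k` communities, membership law `ν` on `ℝ^k` and community
connectivity matrices `P` (users versus resources) and `Pt` (tags versus resources).

The coordinate basis vectors `z` of the model are represented by their index in `Fin k`, so that the
Bernoulli parameter `zᵤᵀ P zᵣ` is the entry `P zᵤ zᵣ`. -/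
structure Model {Ω : Type*} [MeasurableSpace Ω] (μ : Measure Ω)
    (U T R : Type) [Fintype U] [Fintype T] [Fintype R] (k : ℕ)
    (ν : Measure (Fin k → ℝ)) (P Pt : Matrix (Fin k) (Fin k) ℝ) where
  /-- community membership vector of every node -/
  member : U ⊕ T ⊕ R → Ω → (Fin k → ℝ)
  /-- context of the user `u` in the triplet `{u, t, r}` -/
  ctxU : U → T → R → Ω → Fin k
  /-- context of the tag `t` in the triplet `{u, t, r}` -/
  ctxT : U → T → R → Ω → Fin k
  /-- context of the resource `r` in the triplet `{u, t, r}` -/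
  ctxR : U → T → R → Ω → Fin k
  /-- the Bernoulli variable attached to the resource and the user -/
  edgeU : U → T → R → Ω → Bool
  /-- the Bernoulli variable attached to the resource and the tag -/
  edgeT : U → T → R → Ω → Bool
  measurable_member : ∀ i, Measurable (member i)
  measurable_ctxU : ∀ u t r, Measurable (ctxU u t r)
  measurable_ctxT : ∀ u t r, Measurable (ctxT u t r)
  measurable_ctxR : ∀ u t r, Measurable (ctxR u t r)
  measurable_edgeU : ∀ u t r, Measurable (edgeU u t r)
  measurable_edgeT : ∀ u t r, Measurable (edgeT u t r)
  /-- the membership vectors are i.i.d. with law `ν` -/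
  indep_member : iIndepFun member μ
  law_member : ∀ i, μ.map (member i) = ν
  /-- given all the memberships, the contexts are independent, each with the multinomial law of
  the membership vector of its node -/
  law_ctx : ∀ a b c : U → T → R → Fin k,
    μ⟦{ω | ∀ u t r, ctxU u t r ω = a u t r ∧ ctxT u t r ω = b u t r ∧ ctxR u t r ω = c u t r} |
        MeasurableSpace.comap (fun ω i => member i ω) inferInstance⟧
      =ᵐ[μ] fun ω => ∏ u, ∏ t, ∏ r,
        member (Sum.inl u) ω (a u t r) * member (Sum.inr (Sum.inl t)) ω (b u t r) *
          member (Sum.inr (Sum.inr r)) ω (c u t r)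
  /-- given all the memberships and contexts, the edge variables are independent Bernoulli
  variables with the parameters read off from `P` and `Pt` -/
  law_edge : ∀ a b : U → T → R → Bool,
    μ⟦{ω | ∀ u t r, edgeU u t r ω = a u t r ∧ edgeT u t r ω = b u t r} |
        MeasurableSpace.comap
          (fun ω => ((fun i => member i ω),
            (fun u t r => (ctxU u t r ω, ctxT u t r ω, ctxR u t r ω)))) inferInstance⟧
      =ᵐ[μ] fun ω => ∏ u, ∏ t, ∏ r,
        bernWeight (P (ctxU u t r ω) (ctxR u t r ω)) (a u t r) *
          bernWeight (Pt (ctxT u t r ω) (ctxR u t r ω)) (b u t r)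

namespace Model

variable {Ω : Type*} [MeasurableSpace Ω] {μ : Measure Ω}
  {U T R : Type} [Fintype U] [Fintype T] [Fintype R] {k : ℕ}
  {ν : Measure (Fin k → ℝ)} {P Pt : Matrix (Fin k) (Fin k) ℝ}

/-- The σ-algebra generated by all the community membership vectors. -/
abbrev sigmaMember (S : Model μ U T R k ν P Pt) : MeasurableSpace Ω :=
  MeasurableSpace.comap (fun ω i => S.member i ω) inferInstance

/-- The observed matricized hyper-adjacency matrix: the product of the two edge variables. -/
def adj (S : Model μ U T R k ν P Pt) (ω : Ω) : Matrix (U × T) R ℝ :=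
  Matrix.of fun ut r =>
    (if S.edgeU ut.1 ut.2 r ω then 1 else 0) * (if S.edgeT ut.1 ut.2 r ω then 1 else 0)

/-- The exact moment: the conditional expectation of `adj` given all the memberships. -/
noncomputable def expAdj (S : Model μ U T R k ν P Pt) (ω : Ω) : Matrix (U × T) R ℝ :=
  Matrix.of fun ut r => (μ[fun ω' => S.adj ω' ut r | S.sigmaMember]) ω

end Model

/-- `A = W D Vᵀ` is a singular value decomposition (with `l` singular triples): the columns of `W`
and of `V` are orthonormal, and `D` is diagonal with nonnegative nonincreasing entries `d`. -/
def IsSVD {m n : Type*} [Fintype m] [Fintype n] {l : ℕ} (A : Matrix m n ℝ)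
    (W : Matrix m (Fin l) ℝ) (d : Fin l → ℝ) (V : Matrix n (Fin l) ℝ) : Prop :=
  Wᵀ * W = 1 ∧ Vᵀ * V = 1 ∧ (∀ i, 0 ≤ d i) ∧ Antitone d ∧ A = W * Matrix.diagonal d * Vᵀ

/-- `Q = Mₖ Mₖᵀ`, where the columns of `Mₖ` are the first `k` left singular vectors of `A` in some
singular value decomposition of `A`. -/
def IsTopProjection {m n : Type*} [Fintype m] [Fintype n] (k : ℕ) (A : Matrix m n ℝ)
    (Q : Matrix m m ℝ) : Prop :=
  ∃ (l : ℕ) (h : k ≤ l) (W : Matrix m (Fin l) ℝ) (d : Fin l → ℝ) (V : Matrix n (Fin l) ℝ),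
    IsSVD A W d V ∧
      Q = W.submatrix id (Fin.castLE h) * (W.submatrix id (Fin.castLE h))ᵀ

/-- The homogeneous connectivity matrix `(p - q) I + q 1 1ᵀ`. -/
def homogeneous (k : ℕ) (p q : ℝ) : Matrix (Fin k) (Fin k) ℝ :=
  (p - q) • (1 : Matrix (Fin k) (Fin k) ℝ) + q • Matrix.of (fun _ _ => (1 : ℝ))

/-- The second moment matrix `E[π πᵀ]` of a law on `ℝ^k`. -/
noncomputable def secondMoment {k : ℕ} (ν : Measure (Fin k → ℝ)) : Matrix (Fin k) (Fin k) ℝ :=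
  Matrix.of fun i j => ∫ x, x i * x j ∂ν

/-- The `k`-th (smallest) singular value of a `k × k` matrix; Mathlib counts from zero. -/
noncomputable def sigmaMin {k : ℕ} (M : Matrix (Fin k) (Fin k) ℝ) : ℝ :=
  (Matrix.toEuclideanLin M).singularValues (k - 1)

/-- The probability that a membership vector is a coordinate basis vector. -/
noncomputable def pureProb {k : ℕ} (ν : Measure (Fin k → ℝ)) : ℝ :=
  ν.real (Set.range fun i : Fin k => (Pi.single i 1 : Fin k → ℝ))

end MMSF

/-!
Write `L = log (n / δ)`. Given the memberships, the entries of the adjacency array are independent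
Bernoulli variables (`Model.real_members_hit`) whose parameters are the entries of the exact moment
(`Model.expAdj_ae_eq`) and are at most `p²` (`param_le`). So conditional probabilities are finite
sums against a product of Bernoulli laws, and each tail bound below is an instance of one
exponential inequality, `bernProb_martingale_le`.

Let `Q` be the projection and `v` a centred column outside of `Y`; `Q` does not depend on `v`. Since
the variances are at most `p²` and `Q` has trace `k`, the mean of `‖Q v‖²` is at most `k p²`. The
fluctuation is a linear term plus a quadratic chaos. Ordering the coordinates turns their sum into a
martingale transform, and if `Q i i ≤ B` for all `i`, where `B ≥ p²`, it is of order `√k L² B` with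
high probability (`bernProb_projection_le`). The lemma thus follows from the incoherence bound
`Q i i ≤ C p² L²`.

If `p² L²` is bounded below by a constant, the incoherence bound is trivial, because the diagonal
entries of a projection are at most one. Otherwise, testing the second moment matrix on the all-ones
vector gives `σ_k ≤ 1 / k`, so the separation requirement forces `p² ≥ c² k³ / n`
(`separation_sq_le`), whence `k³ L²` is a small multiple of `n`. The singular value decomposition
gives `σ_k(A)² Q i i ≤ ∑ y, A i y²` for the observed block `A` (`IsTopProjection.diag_le`). Row sums
are at most of order `p² n + L`. The `k`-th singular value of `A` is at least the least singular
value of any `k` of its columns, and its square is at least of order `p² |U| |T| / k²`: the Gram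
matrix of these columns exceeds a positive semidefinite matrix by a diagonal part of that order, up
to fluctuations of the inner products of distinct columns (`gram_lower_bound`,
`bernProb_coherent_le`). The lower bound for the diagonal uses that, with high probability, each
community has its share of the users and of the tags (`Model.real_sum_members_le`).
-/

namespace MMSF

/-! ### Products of Bernoulli laws and Bernstein's inequality for martingale transforms -/

section BernoulliProduct

variable {ι : Type*} [Fintype ι]

/-- The value in `{0, 1}` of a Boolean. -/
def bval (b : Bool) : ℝ := if b then 1 else 0

/-- The mass of the configuration `b` under the product of the Bernoulli laws with parameters
`g i`. -/
def bernMass (g : ι → ℝ) (b : ι → Bool) : ℝ := ∏ i, bernWeight (g i) (b i)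

lemma bernWeight_nonneg {a : ℝ} (h0 : 0 ≤ a) (h1 : a ≤ 1) (b : Bool) : 0 ≤ bernWeight a b := by
  cases b <;> simp [bernWeight, h0, h1]

lemma bernMass_nonneg {g : ι → ℝ} (h0 : ∀ i, 0 ≤ g i) (h1 : ∀ i, g i ≤ 1) (b : ι → Bool) :
    0 ≤ bernMass g b :=
  Finset.prod_nonneg fun i _ => bernWeight_nonneg (h0 i) (h1 i) _

variable [DecidableEq ι]

/-- Expectation under the product of the Bernoulli laws with parameters `g i`, as a finite sum. -/
def bernExp (g : ι → ℝ) (f : (ι → Bool) → ℝ) : ℝ := ∑ b, bernMass g b * f b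

/-- Probability of an event under the product of the Bernoulli laws with parameters `g i`. -/
noncomputable def bernProb (g : ι → ℝ) (A : Set (ι → Bool)) : ℝ :=
  bernExp g (A.indicator 1)

lemma bval_nonneg (b : Bool) : 0 ≤ bval b := by cases b <;> simp [bval]

lemma bval_le_one (b : Bool) : bval b ≤ 1 := by cases b <;> simp [bval]

lemma sum_bernWeight (a : ℝ) : ∑ b, bernWeight a b = 1 := by simp [bernWeight]

lemma sum_bernMass (g : ι → ℝ) : ∑ b, bernMass g b = 1 := by
  simp only [bernMass]
  rw [← Fintype.prod_sum]
  exact Finset.prod_eq_one fun i _ => sum_bernWeight _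

lemma bernExp_mono {g : ι → ℝ} (h0 : ∀ i, 0 ≤ g i) (h1 : ∀ i, g i ≤ 1)
    {f f' : (ι → Bool) → ℝ} (h : ∀ b, f b ≤ f' b) : bernExp g f ≤ bernExp g f' :=
  Finset.sum_le_sum fun b _ => mul_le_mul_of_nonneg_left (h b) (bernMass_nonneg h0 h1 b)

lemma bernExp_const (g : ι → ℝ) (c : ℝ) : bernExp g (fun _ => c) = c := by
  rw [bernExp, ← Finset.sum_mul, sum_bernMass, one_mul]

lemma bernProb_mono {g : ι → ℝ} (h0 : ∀ i, 0 ≤ g i) (h1 : ∀ i, g i ≤ 1)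
    {A A' : Set (ι → Bool)} (h : A ⊆ A') : bernProb g A ≤ bernProb g A' :=
  bernExp_mono h0 h1 fun b =>
    Set.indicator_le_indicator_of_subset h (fun _ => zero_le_one) b

lemma bernProb_union_le {g : ι → ℝ} (h0 : ∀ i, 0 ≤ g i) (h1 : ∀ i, g i ≤ 1)
    (A A' : Set (ι → Bool)) : bernProb g (A ∪ A') ≤ bernProb g A + bernProb g A' := by
  simp only [bernProb, bernExp, ← Finset.sum_add_distrib, ← mul_add]
  refine Finset.sum_le_sum fun b _ => mul_le_mul_of_nonneg_left ?_ (bernMass_nonneg h0 h1 b)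
  by_cases hA : b ∈ A <;> by_cases hA' : b ∈ A' <;> simp [hA, hA']

/-- Union bound with a common bound on the probabilities of the events. -/
lemma bernProb_exists_le {g : ι → ℝ} (h0 : ∀ i, 0 ≤ g i) (h1 : ∀ i, g i ≤ 1)
    {κ : Type*} [Fintype κ] (A : κ → Set (ι → Bool)) {e : ℝ} (hA : ∀ j, bernProb g (A j) ≤ e) :
    bernProb g {b | ∃ j, b ∈ A j} ≤ Fintype.card κ * e := by
  have : bernProb g {b | ∃ j, b ∈ A j} ≤ ∑ j, bernProb g (A j) := by
    simp only [bernProb, bernExp]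
    rw [Finset.sum_comm]
    refine Finset.sum_le_sum fun b _ => ?_
    rw [← Finset.mul_sum]
    refine mul_le_mul_of_nonneg_left ?_ (bernMass_nonneg h0 h1 b)
    have hnn : ∀ j ∈ Finset.univ, (0 : ℝ) ≤ (A j).indicator 1 b := fun j _ =>
      Set.indicator_nonneg (fun _ _ => zero_le_one) b
    by_cases hb : ∃ j, b ∈ A j
    · obtain ⟨j, hj⟩ := hb
      rw [Set.indicator_of_mem (show b ∈ {b | ∃ j, b ∈ A j} from ⟨j, hj⟩)]
      refine le_trans ?_ (Finset.single_le_sum hnn (Finset.mem_univ j))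
      simp [hj]
    · rw [Set.indicator_of_notMem (show b ∉ {b | ∃ j, b ∈ A j} from hb)]
      exact Finset.sum_nonneg hnn
  refine this.trans ((Finset.sum_le_sum fun j _ => hA j).trans ?_)
  simp

/-- Markov's inequality in the form used for exponential moments. -/
lemma bernProb_le_of_exp {g : ι → ℝ} (h0 : ∀ i, 0 ≤ g i) (h1 : ∀ i, g i ≤ 1)
    {X : (ι → Bool) → ℝ} {t : ℝ} (hX : bernExp g (fun b => Real.exp (X b)) ≤ 1) :
    bernProb g {b | t ≤ X b} ≤ Real.exp (-t) := by
  have h : bernProb g {b | t ≤ X b} ≤ bernExp g (fun b => Real.exp (-t) * Real.exp (X b)) := by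
    refine bernExp_mono h0 h1 fun b => ?_
    by_cases hb : t ≤ X b
    · rw [Set.indicator_of_mem (by exact hb), Pi.one_apply, ← Real.exp_add, Real.one_le_exp_iff]
      linarith
    · rw [Set.indicator_of_notMem (by exact hb)]
      positivity
  have h' : bernExp g (fun b => Real.exp (-t) * Real.exp (X b))
      = Real.exp (-t) * bernExp g (fun b => Real.exp (X b)) := by
    simp only [bernExp, Finset.mul_sum]
    exact Finset.sum_congr rfl fun b _ => by ring
  rw [h'] at h
  exact h.trans (mul_le_of_le_one_right (Real.exp_pos _).le hX)

lemma bernMass_update_mul (g : ι → ℝ) (b : ι → Bool) (i : ι) (x : Bool) :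
    bernMass g (Function.update b i x) * bernWeight (g i) (b i)
      = bernMass g b * bernWeight (g i) x := by
  simp only [bernMass]
  rw [← Finset.mul_prod_erase _ _ (Finset.mem_univ i),
    ← Finset.mul_prod_erase _ (fun j => bernWeight (g j) (b j)) (Finset.mem_univ i)]
  have : ∏ j ∈ Finset.univ.erase i, bernWeight (g j) (Function.update b i x j)
      = ∏ j ∈ Finset.univ.erase i, bernWeight (g j) (b j) :=
    Finset.prod_congr rfl fun j hj => by
      rw [Function.update_of_ne (Finset.ne_of_mem_erase hj)]
  rw [this, Function.update_self]
  ring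

/-- Averaging over an independent redraw of one coordinate does not change the expectation. The
exchange of the old and the new value of that coordinate is a measure preserving involution. -/
lemma bernExp_resample (g : ι → ℝ) (i : ι) (f : (ι → Bool) → ℝ) :
    bernExp g (fun b => ∑ x, bernWeight (g i) x * f (Function.update b i x)) = bernExp g f := by
  let e : (ι → Bool) × Bool → (ι → Bool) × Bool := fun z => (Function.update z.1 i z.2, z.1 i)
  have he : Function.Involutive e := fun z => by simp [e]
  have h1 : bernExp g (fun b => ∑ x, bernWeight (g i) x * f (Function.update b i x))
      = ∑ z : (ι → Bool) × Bool, bernMass g z.1 * bernWeight (g i) z.2 * f (e z).1 := by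
    rw [Fintype.sum_prod_type]
    simp only [bernExp, Finset.mul_sum, e, mul_assoc]
  have h2 : bernExp g f
      = ∑ z : (ι → Bool) × Bool, bernMass g z.1 * bernWeight (g i) z.2 * f z.1 := by
    rw [Fintype.sum_prod_type]
    simp only [bernExp]
    refine Finset.sum_congr rfl fun b _ => ?_
    have : ∀ x, bernMass g b * bernWeight (g i) x * f b
        = bernWeight (g i) x * (bernMass g b * f b) := fun x => by ring
    simp only [this]
    rw [← Finset.sum_mul, sum_bernWeight, one_mul]
  rw [h1, h2, ← Equiv.sum_comp he.toPerm
    (fun z : (ι → Bool) × Bool => bernMass g z.1 * bernWeight (g i) z.2 * f z.1)]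
  refine Finset.sum_congr rfl fun z _ => ?_
  have h3 : bernMass g (e z).1 * bernWeight (g i) (e z).2
      = bernMass g z.1 * bernWeight (g i) z.2 := bernMass_update_mul g z.1 i z.2
  rw [Function.Involutive.coe_toPerm, h3]

/-- A product of nonnegative factors that are revealed one after the other, each of conditional mean
at most one given the previous ones, has mean at most one. The rank `ord` gives the order in which
the coordinates in `s` are revealed; coordinates outside of `s` may enter all the factors. -/
lemma bernExp_prod_le_one {g : ι → ℝ} (h0 : ∀ i, 0 ≤ g i) (h1 : ∀ i, g i ≤ 1) (ord : ι → ℕ)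
    (s : Finset ι) (f : ι → (ι → Bool) → ℝ) (hf : ∀ i b, 0 ≤ f i b)
    (hadapt : ∀ i ∈ s, ∀ j ∈ s, i ≠ j → ord i ≤ ord j →
      ∀ b x, f i (Function.update b j x) = f i b)
    (hmean : ∀ i ∈ s, ∀ b, ∑ x, bernWeight (g i) x * f i (Function.update b i x) ≤ 1) :
    bernExp g (fun b => ∏ i ∈ s, f i b) ≤ 1 := by
  induction s using Finset.induction_on_max_value ord with
  | empty => simp [bernExp_const]
  | insert a s ha hmax ih =>
    refine le_trans ?_ (ih
      (fun i hi j hj => hadapt i (Finset.mem_insert_of_mem hi) j (Finset.mem_insert_of_mem hj))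
      (fun i hi => hmean i (Finset.mem_insert_of_mem hi)))
    rw [← bernExp_resample g a]
    refine bernExp_mono h0 h1 fun b => ?_
    have hs : ∀ x, ∏ i ∈ s, f i (Function.update b a x) = ∏ i ∈ s, f i b := fun x =>
      Finset.prod_congr rfl fun i hi =>
        hadapt i (Finset.mem_insert_of_mem hi) a (Finset.mem_insert_self a s)
          (fun h => ha (h ▸ hi)) (hmax i hi) b x
    simp only [Finset.prod_insert ha, hs, ← mul_assoc]
    rw [← Finset.sum_mul]
    exact mul_le_of_le_one_left (Finset.prod_nonneg fun i _ => hf i b)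
      (hmean a (Finset.mem_insert_self a s) b)

/-- Exponential moment of a centred Bernoulli variable, for slopes of modulus at most one. -/
lemma bernWeight_exp_le {a : ℝ} (h0 : 0 ≤ a) {s : ℝ} (hs : |s| ≤ 1) :
    ∑ x, bernWeight a x * Real.exp (s * (bval x - a) - s ^ 2 * a) ≤ 1 := by
  have h := (abs_le.1 (Real.abs_exp_sub_one_sub_id_le hs)).2
  have e1 : Real.exp (s * (1 - a) - s ^ 2 * a) = Real.exp s * Real.exp (-(s * a + s ^ 2 * a)) := by
    rw [← Real.exp_add]; ring_nf
  have e2 : Real.exp (s * (0 - a) - s ^ 2 * a) = Real.exp (-(s * a + s ^ 2 * a)) := by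
    ring_nf
  simp only [Fintype.sum_bool, bernWeight, bval, if_true, Bool.false_eq_true, if_false, e1, e2]
  have h3 : a * Real.exp s + (1 - a) ≤ Real.exp (s * a + s ^ 2 * a) := by
    have := Real.add_one_le_exp (s * a + s ^ 2 * a)
    nlinarith
  calc a * (Real.exp s * Real.exp (-(s * a + s ^ 2 * a)))
        + (1 - a) * Real.exp (-(s * a + s ^ 2 * a))
      = (a * Real.exp s + (1 - a)) * Real.exp (-(s * a + s ^ 2 * a)) := by ring
    _ ≤ Real.exp (s * a + s ^ 2 * a) * Real.exp (-(s * a + s ^ 2 * a)) :=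
        mul_le_mul_of_nonneg_right h3 (Real.exp_pos _).le
    _ = 1 := by rw [← Real.exp_add]; simp

/-- Bernstein's inequality for martingale transforms of centred Bernoulli variables: the
coefficient `α i` may depend on the coordinates revealed before `i`. -/
theorem bernProb_martingale_le {g : ι → ℝ} (h0 : ∀ i, 0 ≤ g i) (h1 : ∀ i, g i ≤ 1)
    (ord : ι → ℕ) (s : Finset ι) (α : ι → (ι → Bool) → ℝ) (hα : ∀ i ∈ s, ∀ b, |α i b| ≤ 1)
    (hadapt : ∀ i ∈ s, ∀ j ∈ s, ord i ≤ ord j → ∀ b x, α i (Function.update b j x) = α i b)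
    (t : ℝ) :
    bernProb g {b | t + ∑ i ∈ s, α i b ^ 2 * g i ≤ ∑ i ∈ s, α i b * (bval (b i) - g i)}
      ≤ Real.exp (-t) := by
  have key : bernExp g (fun b => Real.exp
      (∑ i ∈ s, (α i b * (bval (b i) - g i) - α i b ^ 2 * g i))) ≤ 1 := by
    simp only [Real.exp_sum]
    refine bernExp_prod_le_one h0 h1 ord s _ (fun i b => (Real.exp_pos _).le) ?_ ?_
    · intro i hi j hj hij hle b x
      rw [hadapt i hi j hj hle, Function.update_of_ne hij]
    · intro i hi b
      simp only [hadapt i hi i hi le_rfl, Function.update_self]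
      exact bernWeight_exp_le (h0 i) (hα i hi b)
  refine le_trans (bernProb_mono h0 h1 ?_) (bernProb_le_of_exp h0 h1 (t := t) key)
  intro b hb
  simp only [Set.mem_ofPred_eq, Finset.sum_sub_distrib] at hb ⊢
  linarith

end BernoulliProduct

/-! ### Orthogonal projections, leading singular vectors and Gram forms -/

section Projections

variable {J : Type*} [Fintype J]

lemma proj_diag_eq_sum_sq {Q : Matrix J J ℝ} (hs : Qᵀ = Q) (hi : Q * Q = Q) (i : J) :
    Q i i = ∑ j, Q i j ^ 2 := by
  conv_lhs => rw [← hi, Matrix.mul_apply]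
  refine Finset.sum_congr rfl fun j _ => ?_
  rw [sq, ← Matrix.transpose_apply Q i j, hs]

lemma proj_diag_nonneg {Q : Matrix J J ℝ} (hs : Qᵀ = Q) (hi : Q * Q = Q) (i : J) :
    0 ≤ Q i i := by
  rw [proj_diag_eq_sum_sq hs hi]
  positivity

lemma proj_diag_le_one {Q : Matrix J J ℝ} (hs : Qᵀ = Q) (hi : Q * Q = Q) (i : J) :
    Q i i ≤ 1 := by
  have h1 : Q i i ^ 2 ≤ ∑ j, Q i j ^ 2 :=
    Finset.single_le_sum (f := fun j => Q i j ^ 2) (fun _ _ => sq_nonneg _) (Finset.mem_univ i)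
  rw [← proj_diag_eq_sum_sq hs hi] at h1
  nlinarith

lemma proj_sq_le_mul {Q : Matrix J J ℝ} (hs : Qᵀ = Q) (hi : Q * Q = Q) (i j : J) :
    Q i j ^ 2 ≤ Q i i * Q j j := by
  rw [proj_diag_eq_sum_sq hs hi i, proj_diag_eq_sum_sq hs hi j]
  have h : Q i j = ∑ l, Q i l * Q j l := by
    conv_lhs => rw [← hi, Matrix.mul_apply]
    refine Finset.sum_congr rfl fun l _ => ?_
    rw [← Matrix.transpose_apply Q j l, hs]
  rw [h]
  exact Finset.sum_mul_sq_le_sq_mul_sq _ _ _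

lemma proj_sum_sq_mulVec {Q : Matrix J J ℝ} (hs : Qᵀ = Q) (hi : Q * Q = Q) (v : J → ℝ) :
    ∑ i, (Q *ᵥ v) i ^ 2 = ∑ i, v i * ∑ j, Q i j * v j := by
  have h : (Q *ᵥ v) ⬝ᵥ (Q *ᵥ v) = v ⬝ᵥ (Q *ᵥ v) := by
    rw [Matrix.dotProduct_mulVec, ← Matrix.mulVec_transpose, hs, Matrix.mulVec_mulVec, hi,
      dotProduct_comm]
  simp only [dotProduct, Matrix.mulVec] at h ⊢
  simpa only [sq] using h

/-- A quadratic form splits into its diagonal and twice its strictly lower triangular part. -/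
lemma sum_quadratic_eq {Q : Matrix J J ℝ} (hs : Qᵀ = Q) (v : J → ℝ)
    {ord : J → ℕ} (hord : Function.Injective ord) :
    ∑ i, v i * ∑ j, Q i j * v j
      = ∑ i, (Q i i * v i ^ 2 + 2 * v i * ∑ j, if ord j < ord i then Q i j * v j else 0) := by
  classical
  have hQ : ∀ i j, Q j i = Q i j := fun i j => by rw [← Matrix.transpose_apply Q i j, hs]
  have hsplit : ∀ i, v i * ∑ j, Q i j * v j = Q i i * v i ^ 2
      + (∑ j, if ord j < ord i then v i * (Q i j * v j) else 0)
      + ∑ j, if ord i < ord j then v i * (Q i j * v j) else 0 := fun i => by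
    have h1 : Q i i * v i ^ 2 = ∑ j, if j = i then v i * (Q i j * v j) else 0 := by
      rw [Finset.sum_ite_eq' Finset.univ i, if_pos (Finset.mem_univ i)]
      ring
    rw [h1, Finset.mul_sum, ← Finset.sum_add_distrib, ← Finset.sum_add_distrib]
    refine Finset.sum_congr rfl fun j _ => ?_
    rcases lt_trichotomy (ord j) (ord i) with h | h | h
    · have : j ≠ i := fun e => by simp [e] at h
      simp [h, this, h.not_gt]
    · simp [hord h]
    · have : j ≠ i := fun e => by simp [e] at h
      simp [h, this, h.not_gt]
  have hswap : ∑ i, ∑ j, (if ord i < ord j then v i * (Q i j * v j) else 0)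
      = ∑ i, ∑ j, if ord j < ord i then v i * (Q i j * v j) else 0 := by
    rw [Finset.sum_comm]
    refine Finset.sum_congr rfl fun i _ => Finset.sum_congr rfl fun j _ => ?_
    rw [hQ i j]
    split_ifs <;> ring
  rw [Finset.sum_congr rfl fun i _ => hsplit i, Finset.sum_add_distrib, Finset.sum_add_distrib,
    hswap, add_assoc, ← Finset.sum_add_distrib, ← Finset.sum_add_distrib]
  refine Finset.sum_congr rfl fun i _ => ?_
  rw [add_right_inj, ← two_mul, mul_assoc, Finset.mul_sum (a := v i)]
  congr 1
  refine Finset.sum_congr rfl fun j _ => ?_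
  split_ifs <;> ring

end Projections

section TopProjection

variable {m n : Type*} [Fintype m] [Fintype n] {k : ℕ} {A : Matrix m n ℝ} {Q : Matrix m m ℝ}

lemma topFactor_orthonormal {l : ℕ} (h : k ≤ l) {W : Matrix m (Fin l) ℝ} (hW : Wᵀ * W = 1) :
    (W.submatrix id (Fin.castLE h))ᵀ * W.submatrix id (Fin.castLE h) = 1 := by
  ext i j
  have := congrFun (congrFun hW (Fin.castLE h i)) (Fin.castLE h j)
  simpa [Matrix.mul_apply, Matrix.one_apply] using this

lemma IsTopProjection.transpose_eq (hQ : IsTopProjection k A Q) : Qᵀ = Q := by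
  obtain ⟨l, h, W, d, V, -, rfl⟩ := hQ
  simp

lemma IsTopProjection.mul_self (hQ : IsTopProjection k A Q) : Q * Q = Q := by
  obtain ⟨l, h, W, d, V, ⟨hW, -⟩, rfl⟩ := hQ
  rw [Matrix.mul_assoc, ← Matrix.mul_assoc _ (W.submatrix id (Fin.castLE h)),
    topFactor_orthonormal h hW, Matrix.one_mul]

lemma IsTopProjection.trace_eq (hQ : IsTopProjection k A Q) : ∑ i, Q i i = k := by
  obtain ⟨l, h, W, d, V, ⟨hW, -⟩, rfl⟩ := hQ
  change Matrix.trace _ = _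
  rw [Matrix.trace_mul_comm, topFactor_orthonormal h hW, Matrix.trace_one, Fintype.card_fin]

/-- Incoherence of the leading left singular vectors: if `k` of the columns of `A` are
quantitatively independent with constant `a`, then the `k`-th singular value of `A` is at least
`√a`, so each row of `Q = A V D⁻² Vᵀ Aᵀ` is small compared with the same row of `A`. -/
theorem IsTopProjection.diag_le (hQ : IsTopProjection k A Q) (hk : 0 < k) (Y : Finset n)
    (hY : Y.card = k) {a : ℝ}
    (ha : ∀ w : n → ℝ, (∀ y ∉ Y, w y = 0) → a * ∑ y, w y ^ 2 ≤ ∑ i, (A *ᵥ w) i ^ 2) (i : m) :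
    a * Q i i ≤ ∑ y, A i y ^ 2 := by
  classical
  obtain ⟨l, h, W, d, V, ⟨hW, hV, hd, hanti, rfl⟩, rfl⟩ := hQ
  let κ : Fin l := ⟨k - 1, by omega⟩
  -- A nonzero combination of the `k` columns orthogonal to the first `k - 1` right singular
  -- vectors is expanded by at most the `k`-th singular value.
  have hκ : a ≤ d κ ^ 2 := by
    let φ : (Y → ℝ) →ₗ[ℝ] (Fin (k - 1) → ℝ) :=
      Matrix.mulVecLin (Matrix.of fun (j : Fin (k - 1)) (y : Y) => V y ⟨j, by omega⟩)
    have hker : LinearMap.ker φ ≠ ⊥ := by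
      apply LinearMap.ker_ne_bot_of_finrank_lt
      simp [hY]
      omega
    obtain ⟨w₀, hw₀, hne⟩ := (Submodule.ne_bot_iff _).1 hker
    let w : n → ℝ := fun y => if hy : y ∈ Y then w₀ ⟨y, hy⟩ else 0
    have hwY : ∀ y ∉ Y, w y = 0 := fun y hy => by simp [w, hy]
    have hsum : ∀ f : n → ℝ, ∑ y, f y * w y = ∑ y : Y, f y * w₀ y := fun f => by
      rw [← Finset.sum_subset (Finset.subset_univ Y)
        (fun y _ hy => by simp [hwY y hy]), ← Finset.sum_coe_sort]
      exact Finset.sum_congr rfl fun y _ => by simp [w]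
    have hpos : 0 < ∑ y, w y ^ 2 := by
      obtain ⟨y, hy⟩ := Function.ne_iff.1 hne
      refine Finset.sum_pos' (fun _ _ => sq_nonneg _) ⟨y, Finset.mem_univ _, ?_⟩
      have : w y ≠ 0 := by simpa [w] using hy
      positivity
    let x : Fin l → ℝ := Vᵀ *ᵥ w
    have hx0 : ∀ j : Fin l, j < κ → x j = 0 := fun j hj => by
      have h1 := congrFun (LinearMap.mem_ker.1 hw₀) ⟨j, hj⟩
      simp only [φ, Matrix.mulVecLin_apply, Matrix.mulVec, dotProduct, Matrix.of_apply,
        Pi.zero_apply] at h1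
      simp only [x, Matrix.mulVec, dotProduct, Matrix.transpose_apply]
      rw [hsum]
      exact h1
    have hbessel : x ⬝ᵥ x ≤ w ⬝ᵥ w := by
      have h1 : 0 ≤ (w - V *ᵥ x) ⬝ᵥ (w - V *ᵥ x) := by
        simp only [dotProduct]
        exact Finset.sum_nonneg fun _ _ => mul_self_nonneg _
      have h2 : (V *ᵥ x) ⬝ᵥ w = x ⬝ᵥ x := by
        rw [dotProduct_comm, Matrix.dotProduct_mulVec, ← Matrix.mulVec_transpose]
      have h3 : (V *ᵥ x) ⬝ᵥ (V *ᵥ x) = x ⬝ᵥ x := by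
        rw [Matrix.dotProduct_mulVec, ← Matrix.mulVec_transpose, Matrix.mulVec_mulVec, hV,
          Matrix.one_mulVec]
      rw [sub_dotProduct, dotProduct_sub, dotProduct_sub, h3, h2, dotProduct_comm w (V *ᵥ x),
        h2] at h1
      linarith
    have hAw : ∑ i, ((W * Matrix.diagonal d * Vᵀ) *ᵥ w) i ^ 2 = ∑ j, (d j * x j) ^ 2 := by
      have h1 : (W * Matrix.diagonal d * Vᵀ) *ᵥ w = W *ᵥ (fun j => d j * x j) := by
        rw [← Matrix.mulVec_mulVec, ← Matrix.mulVec_mulVec]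
        congr 1
        ext j
        rw [Matrix.mulVec_diagonal]
      rw [h1]
      have h2 : (W *ᵥ (fun j => d j * x j)) ⬝ᵥ (W *ᵥ (fun j => d j * x j))
          = (fun j => d j * x j) ⬝ᵥ (fun j => d j * x j) := by
        rw [Matrix.dotProduct_mulVec, ← Matrix.mulVec_transpose, Matrix.mulVec_mulVec, hW,
          Matrix.one_mulVec]
      simpa only [dotProduct, sq] using h2
    have hle : ∑ j, (d j * x j) ^ 2 ≤ d κ ^ 2 * ∑ y, w y ^ 2 := by
      have h1 : ∑ j, (d j * x j) ^ 2 ≤ d κ ^ 2 * (x ⬝ᵥ x) := by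
        rw [dotProduct, Finset.mul_sum]
        refine Finset.sum_le_sum fun j _ => ?_
        rcases lt_or_ge j κ with hj | hj
        · simp [hx0 j hj]
        · rw [mul_pow, ← sq (x j)]
          have := hanti hj
          have := hd j
          gcongr
      refine h1.trans ?_
      have : w ⬝ᵥ w = ∑ y, w y ^ 2 := by simp only [dotProduct, sq]
      rw [← this]
      gcongr
    have := (ha w hwY).trans (hAw.trans_le hle)
    exact le_of_mul_le_mul_right this hpos
  have hrow : ∑ y, (W * Matrix.diagonal d * Vᵀ) i y ^ 2 = ∑ j, (W i j * d j) ^ 2 := by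
    have h1 : (W * Matrix.diagonal d * Vᵀ) * (W * Matrix.diagonal d * Vᵀ)ᵀ
        = (W * Matrix.diagonal d) * (W * Matrix.diagonal d)ᵀ := by
      rw [Matrix.transpose_mul, Matrix.transpose_transpose, Matrix.mul_assoc,
        ← Matrix.mul_assoc Vᵀ, hV, Matrix.one_mul]
    have h2 := congrFun (congrFun h1 i) i
    rw [Matrix.mul_apply, Matrix.mul_apply] at h2
    simpa only [Matrix.transpose_apply, Matrix.mul_diagonal, ← sq] using h2
  rw [hrow, Matrix.mul_apply, Finset.mul_sum]
  have hinj : Function.Injective (Fin.castLE h) := Fin.castLE_injective h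
  calc ∑ j : Fin k, a * (W.submatrix id (Fin.castLE h) i j
          * (W.submatrix id (Fin.castLE h))ᵀ j i)
      ≤ ∑ j : Fin k, (W i (Fin.castLE h j) * d (Fin.castLE h j)) ^ 2 := by
        refine Finset.sum_le_sum fun j _ => ?_
        have h1 : d κ ≤ d (Fin.castLE h j) := hanti (by
          rw [Fin.le_def]; simp only [κ, Fin.val_castLE]; omega)
        have h2 : a ≤ d (Fin.castLE h j) ^ 2 :=
          hκ.trans (pow_le_pow_left₀ (hd κ) h1 2)
        simp only [Matrix.transpose_apply, Matrix.submatrix_apply, id]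
        rw [mul_pow, ← sq, mul_comm]
        gcongr
    _ = ∑ j ∈ Finset.univ.map ⟨Fin.castLE h, hinj⟩, (W i j * d j) ^ 2 := by
        rw [Finset.sum_map]; rfl
    _ ≤ ∑ j, (W i j * d j) ^ 2 :=
        Finset.sum_le_sum_of_subset_of_nonneg (Finset.subset_univ _) fun _ _ _ => sq_nonneg _

/-- Lower bound for the Gram form of `k` columns with entries in `{0, 1}`, comparing it with the
positive semidefinite Gram form of a matrix `G`: the column sums dominate the diagonal, and the
remaining entries of the difference of the two Gram matrices are bounded by `Δ`. -/
theorem gram_lower_bound {G : Matrix m n ℝ} (h01 : ∀ i y, A i y ^ 2 = A i y) (Y : Finset n)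
    {a Δ : ℝ} (hΔ : 0 ≤ Δ) (hdeg : ∀ y ∈ Y, a ≤ ∑ i, A i y - ∑ i, G i y ^ 2)
    (hcross : ∀ y ∈ Y, ∀ y' ∈ Y, y ≠ y' →
      |∑ i, A i y * A i y' - ∑ i, G i y * G i y'| ≤ Δ)
    (w : n → ℝ) (hw : ∀ y ∉ Y, w y = 0) :
    (a - Y.card * Δ) * ∑ y, w y ^ 2 ≤ ∑ i, (A *ᵥ w) i ^ 2 := by
  classical
  have hexp : ∀ B : Matrix m n ℝ, ∑ i, (B *ᵥ w) i ^ 2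
      = ∑ y ∈ Y, ∑ y' ∈ Y, w y * w y' * ∑ i, B i y * B i y' := fun B => by
    have h1 : ∀ i, (B *ᵥ w) i = ∑ y ∈ Y, B i y * w y := fun i => by
      rw [Matrix.mulVec, dotProduct]
      exact (Finset.sum_subset (Finset.subset_univ Y) fun y _ hy => by simp [hw y hy]).symm
    simp only [h1, sq, Finset.sum_mul_sum]
    rw [Finset.sum_comm]
    refine Finset.sum_congr rfl fun y _ => ?_
    rw [Finset.sum_comm]
    refine Finset.sum_congr rfl fun y' _ => ?_
    rw [Finset.mul_sum]
    exact Finset.sum_congr rfl fun i _ => by ring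
  have hterm : ∀ y ∈ Y, ∀ y' ∈ Y,
      w y * w y' * (∑ i, G i y * G i y') + ((if y = y' then a * w y ^ 2 else 0)
        - Δ * (|w y| * |w y'|)) ≤ w y * w y' * ∑ i, A i y * A i y' := fun y hy y' hy' => by
    by_cases h : y = y'
    · subst h
      have h1 := hdeg y hy
      have h2 : ∑ i, A i y * A i y = ∑ i, A i y :=
        Finset.sum_congr rfl fun i _ => by rw [← sq, h01]
      have h3 : ∑ i, G i y * G i y = ∑ i, G i y ^ 2 :=
        Finset.sum_congr rfl fun i _ => by rw [sq]
      rw [if_pos rfl, h2, h3, ← abs_mul, abs_mul_self]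
      nlinarith [mul_nonneg hΔ (mul_self_nonneg (w y)), mul_self_nonneg (w y)]
    · rw [if_neg h]
      have h1 := hcross y hy y' hy' h
      have h2 : -(Δ * (|w y| * |w y'|))
          ≤ w y * w y' * (∑ i, A i y * A i y' - ∑ i, G i y * G i y') := by
        have h3 := neg_abs_le (w y * w y' * (∑ i, A i y * A i y' - ∑ i, G i y * G i y'))
        rw [abs_mul, abs_mul] at h3
        nlinarith [mul_le_mul_of_nonneg_left h1 (mul_nonneg (abs_nonneg (w y)) (abs_nonneg (w y')))]
      linarith
  have hsq : ∑ y, w y ^ 2 = ∑ y ∈ Y, w y ^ 2 :=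
    (Finset.sum_subset (Finset.subset_univ Y) fun y _ hy => by simp [hw y hy]).symm
  have hcs : (∑ y ∈ Y, |w y|) ^ 2 ≤ Y.card * ∑ y ∈ Y, w y ^ 2 := by
    simpa only [sq_abs] using sq_sum_le_card_mul_sum_sq (s := Y) (f := fun y => |w y|)
  have hG : 0 ≤ ∑ i, (G *ᵥ w) i ^ 2 := Finset.sum_nonneg fun _ _ => sq_nonneg _
  have htot := Finset.sum_le_sum fun y hy => Finset.sum_le_sum fun y' hy' => hterm y hy y' hy'
  simp only [Finset.sum_add_distrib, Finset.sum_sub_distrib, Finset.sum_ite_eq] at htot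
  rw [← hexp A, ← hexp G] at htot
  have h4 : ∑ y ∈ Y, ∑ y' ∈ Y, Δ * (|w y| * |w y'|) = Δ * (∑ y ∈ Y, |w y|) ^ 2 := by
    rw [sq, Finset.sum_mul_sum, Finset.mul_sum]
    exact Finset.sum_congr rfl fun y _ => (Finset.mul_sum _ _ _).symm
  have h5 : ∑ y ∈ Y, (if y ∈ Y then a * w y ^ 2 else 0) = a * ∑ y ∈ Y, w y ^ 2 := by
    rw [Finset.mul_sum]
    exact Finset.sum_congr rfl fun y hy => if_pos hy
  rw [h4, h5] at htot
  rw [hsq]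
  nlinarith [mul_le_mul_of_nonneg_left hcs hΔ]

end TopProjection

/-! ### Projection of an independent Bernoulli column -/

section Chaos

variable {J R : Type*}

/-- The column `x` of the array of centred Bernoulli variables. -/
def centredCol (g : J × R → ℝ) (x : R) (b : J × R → Bool) (i : J) : ℝ :=
  bval (b (i, x)) - g (i, x)

lemma sum_column [Fintype J] (x : R) (f : J × R → ℝ) :
    ∑ e ∈ Finset.univ.map ⟨fun i : J => (i, x), fun _ _ h => (Prod.ext_iff.1 h).1⟩, f e
      = ∑ i, f (i, x) := by
  rw [Finset.sum_map]; rfl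

lemma centredCol_update_of_ne [DecidableEq J] [DecidableEq R] (g : J × R → ℝ) (x : R)
    (b : J × R → Bool) {i j : J} (h : i ≠ j) (z : Bool) :
    centredCol g x (Function.update b (j, x) z) i = centredCol g x b i := by
  rw [centredCol, Function.update_of_ne (by simpa using h)]; rfl

variable [Fintype J] [DecidableEq J] [DecidableEq R]

/-- The strictly lower triangular part of `Q v`, where `v` is the centred column `x`. -/
noncomputable def lowerPart (g : J × R → ℝ) (x : R) (ord : J → ℕ)
    (Q : (J × R → Bool) → Matrix J J ℝ) (i : J) (b : J × R → Bool) : ℝ :=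
  ∑ j, if ord j < ord i then Q b i j * centredCol g x b j else 0

lemma lowerPart_update {g : J × R → ℝ} {x : R} {ord : J → ℕ}
    {Q : (J × R → Bool) → Matrix J J ℝ}
    (hQx : ∀ b i z, Q (Function.update b (i, x) z) = Q b) {i j : J} (h : ord i ≤ ord j)
    (b : J × R → Bool) (z : Bool) :
    lowerPart g x ord Q i (Function.update b (j, x) z) = lowerPart g x ord Q i b := by
  refine Finset.sum_congr rfl fun l _ => ?_
  split_ifs with hl
  · rw [hQx, centredCol_update_of_ne]
    rintro rfl
    omega
  · rfl

variable [Fintype R]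

/-- Bernstein's inequality for a martingale transform along the column `x`; the coefficients may
depend on all other columns. -/
theorem bernProb_column_le {g : J × R → ℝ} (h0 : ∀ e, 0 ≤ g e) (h1 : ∀ e, g e ≤ 1) (x : R)
    (ord : J → ℕ) (α : J → (J × R → Bool) → ℝ) (hα : ∀ i b, |α i b| ≤ 1)
    (hadapt : ∀ i j, ord i ≤ ord j → ∀ b z, α i (Function.update b (j, x) z) = α i b) (t : ℝ) :
    bernProb g {b | t + ∑ i, α i b ^ 2 * g (i, x) ≤ ∑ i, α i b * centredCol g x b i}
      ≤ Real.exp (-t) := by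
  have h := bernProb_martingale_le h0 h1 (fun e => ord e.1)
    (Finset.univ.map ⟨fun i : J => (i, x), fun _ _ h => (Prod.ext_iff.1 h).1⟩)
    (fun e => α e.1) (fun e _ => hα e.1) ?_ t
  · simp only [sum_column] at h
    exact h
  · intro e _ e' he' hle b z
    obtain ⟨j, -, rfl⟩ := Finset.mem_map.1 he'
    exact hadapt e.1 j hle b z

/-- Tail of a single coordinate of the lower triangular part. The sign `ε` allows for both tails. -/
theorem bernProb_lowerPart_le {g : J × R → ℝ} (h0 : ∀ e, 0 ≤ g e) (h1 : ∀ e, g e ≤ 1) {x : R}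
    {ord : J → ℕ} {Q : (J × R → Bool) → Matrix J J ℝ}
    (hQx : ∀ b i z, Q (Function.update b (i, x) z) = Q b)
    (hs : ∀ b, (Q b)ᵀ = Q b) (hi : ∀ b, Q b * Q b = Q b)
    {v B : ℝ} (hg : ∀ i, g (i, x) ≤ v) (hB : 0 < B) (hvB : v ≤ B) (t : ℝ) (i : J)
    {ε : ℝ} (hε : |ε| = 1) :
    bernProb g {b | (∀ j, Q b j j ≤ B) ∧
      (t + 1) * √(Q b i i * B) < ε * lowerPart g x ord Q i b} ≤ Real.exp (-t) := by
  classical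
  let α : J → (J × R → Bool) → ℝ := fun j b =>
    if (∀ l, Q b l l ≤ B) ∧ ord j < ord i then ε * Q b i j / √(Q b i i * B) else 0
  have hεsq : ε ^ 2 = 1 := by rw [← sq_abs, hε, one_pow]
  have hentry : ∀ b, (∀ l, Q b l l ≤ B) → ∀ j, Q b i j ^ 2 ≤ Q b i i * B := fun b hb j =>
    (proj_sq_le_mul (hs b) (hi b) i j).trans
      (mul_le_mul_of_nonneg_left (hb j) (proj_diag_nonneg (hs b) (hi b) i))
  have hα : ∀ j b, |α j b| ≤ 1 := fun j b => by
    simp only [α]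
    split_ifs with h
    · rw [abs_div, abs_mul, hε, one_mul, abs_of_nonneg (Real.sqrt_nonneg _)]
      exact div_le_one_of_le₀ (Real.abs_le_sqrt (hentry b h.1 j)) (Real.sqrt_nonneg _)
    · simp
  refine le_trans (bernProb_mono h0 h1 ?_)
    (bernProb_column_le h0 h1 x ord α hα (fun j l _ b z => by simp only [α, hQx]) t)
  rintro b ⟨hb, hlt⟩
  rw [Set.mem_ofPred_eq]
  have hvar : ∑ j, α j b ^ 2 * g (j, x) ≤ 1 := by
    rcases (mul_nonneg (proj_diag_nonneg (hs b) (hi b) i) hB.le).eq_or_lt with hz | hz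
    · have : ∀ j, α j b = 0 := fun j => by simp [α, ← hz]
      simp [this]
    have h2 : ∀ j, α j b ^ 2 * g (j, x) ≤ Q b i j ^ 2 / (Q b i i * B) * v := fun j => by
      refine mul_le_mul ?_ (hg j) (h0 _) (by positivity)
      simp only [α]
      split_ifs
      · rw [div_pow, mul_pow, hεsq, one_mul, Real.sq_sqrt hz.le]
      · rw [zero_pow two_ne_zero]; positivity
    refine (Finset.sum_le_sum fun j _ => h2 j).trans ?_
    rw [← Finset.sum_mul, ← Finset.sum_div, ← proj_diag_eq_sum_sq (hs b) (hi b)]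
    rw [div_mul_eq_mul_div, div_le_one hz]
    exact mul_le_mul_of_nonneg_left hvB (proj_diag_nonneg (hs b) (hi b) i)
  have hsum : ∑ j, α j b * centredCol g x b j
      = ε * lowerPart g x ord Q i b / √(Q b i i * B) := by
    rw [lowerPart, Finset.mul_sum, Finset.sum_div]
    refine Finset.sum_congr rfl fun j _ => ?_
    simp only [α, hb, implies_true, true_and]
    split_ifs <;> ring
  rcases (mul_nonneg (proj_diag_nonneg (hs b) (hi b) i) hB.le).eq_or_lt with hz | hz
  · -- A vanishing diagonal entry forces its whole row to vanish.
    have hrow : ∀ j, Q b i j = 0 := fun j => by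
      have := hentry b hb j
      rw [← hz] at this
      exact pow_eq_zero_iff two_ne_zero |>.1 (le_antisymm this (sq_nonneg _))
    simp [lowerPart, hrow] at hlt
  · rw [hsum]
    have : t + 1 < ε * lowerPart g x ord Q i b / √(Q b i i * B) :=
      (lt_div_iff₀ (Real.sqrt_pos.2 hz)).2 hlt
    linarith

/-- Hanson–Wright type bound for the projection of a column of centred Bernoulli variables of
variance at most `v` onto a `k`-dimensional subspace that is independent of the column and
incoherent at level `B`. After expanding the square, the linear and the off-diagonal terms form one
martingale, whose coefficients are truncated at their typical size. -/
theorem bernProb_projection_le {g : J × R → ℝ} (h0 : ∀ e, 0 ≤ g e) (h1 : ∀ e, g e ≤ 1) {x : R}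
    {Q : (J × R → Bool) → Matrix J J ℝ}
    (hQx : ∀ b i z, Q (Function.update b (i, x) z) = Q b)
    (hs : ∀ b, (Q b)ᵀ = Q b) (hi : ∀ b, Q b * Q b = Q b) {k : ℕ} (hk : 0 < k)
    (htr : ∀ b, ∑ i, Q b i i = k)
    {v B : ℝ} (hg : ∀ i, g (i, x) ≤ v) (hB : 0 < B) (hvB : v ≤ B) {t : ℝ} (ht : 2 ≤ t) :
    bernProb g {b | (∀ j, Q b j j ≤ B) ∧
      k * v + 10 * t ^ 2 * B * √k < ∑ i, (Q b *ᵥ centredCol g x b) i ^ 2}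
        ≤ (2 * Fintype.card J + 1) * Real.exp (-t) := by
  classical
  let ord : J → ℕ := fun i => Fintype.equivFin J i
  have hord : Function.Injective ord :=
    Fin.val_injective.comp (Fintype.equivFin J).injective
  have hk1 : (1 : ℝ) ≤ k := by exact_mod_cast hk
  have hsk : 1 ≤ √(k : ℝ) := Real.one_le_sqrt.2 hk1
  have hsk0 : 0 < √(k : ℝ) := by positivity
  -- With this slope the truncated coefficients are at most one, and since the diagonal of `Q` sums
  -- to `k` their total variance is at most `v / B`.
  let lam : ℝ := 1 / (5 * t * B * √k)
  have hlam : 0 < lam := by positivity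
  let coef : J → (J × R → Bool) → ℝ := fun i b =>
    Q b i i * (1 - 2 * g (i, x)) + 2 * lowerPart g x ord Q i b
  let α : J → (J × R → Bool) → ℝ := fun i b =>
    if (∀ l, Q b l l ≤ B) ∧ |lowerPart g x ord Q i b| ≤ (t + 1) * √(Q b i i * B) then
      lam * coef i b else 0
  have hq0 : ∀ b i, 0 ≤ Q b i i := fun b i => proj_diag_nonneg (hs b) (hi b) i
  have hcoef : ∀ b, (∀ l, Q b l l ≤ B) → ∀ i,
      |lowerPart g x ord Q i b| ≤ (t + 1) * √(Q b i i * B) →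
      |coef i b| ≤ 5 * t * √(Q b i i * B) := fun b hb i hl => by
    have h2 : |Q b i i * (1 - 2 * g (i, x))| ≤ √(Q b i i * B) := by
      rw [abs_mul, abs_of_nonneg (hq0 b i)]
      have h3 : |1 - 2 * g (i, x)| ≤ 1 :=
        abs_le.2 ⟨by linarith [h1 (i, x)], by linarith [h0 (i, x)]⟩
      have h4 : Q b i i ≤ √(Q b i i * B) :=
        Real.le_sqrt_of_sq_le (by nlinarith [hb i, hq0 b i])
      nlinarith [hq0 b i]
    calc |coef i b| ≤ |Q b i i * (1 - 2 * g (i, x))| + |2 * lowerPart g x ord Q i b| :=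
          abs_add_le _ _
      _ ≤ √(Q b i i * B) + 2 * ((t + 1) * √(Q b i i * B)) := by
          rw [abs_mul 2, abs_two]
          linarith
      _ ≤ 5 * t * √(Q b i i * B) := by nlinarith [Real.sqrt_nonneg (Q b i i * B)]
  have hα2 : ∀ b i, α i b ^ 2 ≤ Q b i i / (B * k) := fun b i => by
    simp only [α]
    split_ifs with h
    · have h2 : (lam * coef i b) ^ 2 ≤ (lam * (5 * t * √(Q b i i * B))) ^ 2 := by
        rw [← sq_abs, abs_mul, abs_of_pos hlam]
        gcongr
        exact hcoef b h.1 i h.2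
      refine h2.trans (le_of_eq ?_)
      rw [mul_pow, mul_pow, Real.sq_sqrt (mul_nonneg (hq0 b i) hB.le)]
      simp only [lam]
      rw [div_pow, mul_pow _ (√(k : ℝ)), Real.sq_sqrt (by positivity)]
      have : t ≠ 0 := by positivity
      field_simp
    · rw [zero_pow two_ne_zero]
      have := hq0 b i
      positivity
  have hα : ∀ i b, |α i b| ≤ 1 := fun i b => by
    by_cases h : (∀ l, Q b l l ≤ B) ∧ |lowerPart g x ord Q i b| ≤ (t + 1) * √(Q b i i * B)
    · have h2 : α i b ^ 2 ≤ 1 := (hα2 b i).trans (by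
        rw [div_le_one (by positivity)]
        nlinarith [h.1 i])
      exact abs_le_one_iff_mul_self_le_one.2 (by rwa [← sq])
    · simp [α, h]
  have hmain := bernProb_column_le h0 h1 x ord α hα
    (fun i j hij b z => by simp only [α, coef, hQx, lowerPart_update hQx hij]) t
  have hup := bernProb_exists_le h0 h1 _ fun i : J =>
    bernProb_lowerPart_le h0 h1 hQx hs hi hg hB hvB t i (ord := ord) (ε := 1) (by simp)
  have hlo := bernProb_exists_le h0 h1 _ fun i : J =>
    bernProb_lowerPart_le h0 h1 hQx hs hi hg hB hvB t i (ord := ord) (ε := -1) (by simp)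
  refine le_trans (bernProb_mono h0 h1 ?_) ((bernProb_union_le h0 h1 _ _).trans
    (add_le_add ((bernProb_union_le h0 h1 _ _).trans (add_le_add hup hlo)) hmain) |>.trans ?_)
  · rintro b ⟨hb, hlt⟩
    by_contra hcon
    simp only [Set.mem_union, Set.mem_ofPred_eq, not_or, not_exists, not_and, not_lt, one_mul,
      neg_mul, not_le] at hcon
    obtain ⟨⟨hc1, hc2⟩, hc3⟩ := hcon
    have htyp : ∀ i, |lowerPart g x ord Q i b| ≤ (t + 1) * √(Q b i i * B) := fun i =>
      abs_le'.2 ⟨hc1 i hb, hc2 i hb⟩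
    have hαb : ∀ i, α i b = lam * coef i b := fun i => if_pos ⟨hb, htyp i⟩
    have hvar : ∑ i, α i b ^ 2 * g (i, x) ≤ 1 := by
      calc ∑ i, α i b ^ 2 * g (i, x) ≤ ∑ i, Q b i i / (B * k) * v :=
            Finset.sum_le_sum fun i _ => mul_le_mul (hα2 b i) (hg i) (h0 _)
              (by have := hq0 b i; positivity)
        _ = v / B := by
            rw [← Finset.sum_mul, ← Finset.sum_div, htr]
            field_simp
        _ ≤ 1 := div_le_one_of_le₀ hvB hB.le
    have hlin : ∑ i, coef i b * centredCol g x b i ≤ 10 * t ^ 2 * B * √k := by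
      have h2 : lam * ∑ i, coef i b * centredCol g x b i ≤ t + 1 := by
        rw [Finset.mul_sum]
        have : ∑ i, lam * (coef i b * centredCol g x b i) = ∑ i, α i b * centredCol g x b i :=
          Finset.sum_congr rfl fun i _ => by rw [hαb, mul_assoc]
        rw [this]
        linarith
      simp only [lam] at h2
      rw [div_mul_eq_mul_div, one_mul, div_le_iff₀ (by positivity)] at h2
      refine h2.trans ?_
      have : 0 ≤ B * √(k : ℝ) * t := by positivity
      nlinarith
    have hident : ∑ i, (Q b *ᵥ centredCol g x b) i ^ 2
        = ∑ i, Q b i i * (g (i, x) * (1 - g (i, x))) + ∑ i, coef i b * centredCol g x b i := by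
      rw [proj_sum_sq_mulVec (hs b) (hi b), sum_quadratic_eq (hs b) _ hord,
        ← Finset.sum_add_distrib]
      refine Finset.sum_congr rfl fun i _ => ?_
      -- For a Boolean `b` one has `(b - g)² = g (1 - g) + (1 - 2 g) (b - g)`.
      have h2 : centredCol g x b i ^ 2
          = g (i, x) * (1 - g (i, x)) + (1 - 2 * g (i, x)) * centredCol g x b i := by
        simp only [centredCol, bval]
        split_ifs <;> ring
      rw [h2]
      simp only [coef, lowerPart]
      ring
    have hdiag : ∑ i, Q b i i * (g (i, x) * (1 - g (i, x))) ≤ k * v := by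
      rw [← htr b, Finset.sum_mul]
      refine Finset.sum_le_sum fun i _ => mul_le_mul_of_nonneg_left ?_ (hq0 b i)
      nlinarith [hg i, h0 (i, x), h1 (i, x)]
    linarith
  · apply le_of_eq; ring

end Chaos

/-! ### Incoherence of the leading singular vectors -/

section Incoherence

variable {J R : Type*} [Fintype J] [Fintype R] [DecidableEq J] [DecidableEq R]

/-- The `{0, 1}`-matrix of a Boolean array. -/
def bmat (b : J × R → Bool) : Matrix J R ℝ := Matrix.of fun i r => bval (b (i, r))

/-- Upper tail for the number of ones in a block of coordinates. -/
lemma bernProb_sum_upper {g : J × R → ℝ} (h0 : ∀ e, 0 ≤ g e) (h1 : ∀ e, g e ≤ 1)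
    (s : Finset (J × R)) (t : ℝ) :
    bernProb g {b | t + 2 * ∑ e ∈ s, g e < ∑ e ∈ s, bval (b e)} ≤ Real.exp (-t) := by
  refine le_trans (bernProb_mono h0 h1 ?_) (bernProb_martingale_le h0 h1 (fun _ => 0) s
    (fun _ _ => 1) (fun _ _ _ => by simp) (fun _ _ _ _ _ _ _ => rfl) t)
  intro b hb
  simp only [Set.mem_ofPred_eq, one_pow, one_mul, Finset.sum_sub_distrib] at hb ⊢
  linarith

/-- Lower tail for the number of ones in a block of coordinates. -/
lemma bernProb_sum_lower {g : J × R → ℝ} (h0 : ∀ e, 0 ≤ g e) (h1 : ∀ e, g e ≤ 1)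
    (s : Finset (J × R)) (t : ℝ) :
    bernProb g {b | ∑ e ∈ s, bval (b e) < (∑ e ∈ s, g e) / 2 - 2 * t} ≤ Real.exp (-t) := by
  refine le_trans (bernProb_mono h0 h1 ?_) (bernProb_martingale_le h0 h1 (fun _ => 0) s
    (fun _ _ => -1 / 2) (fun _ _ _ => by norm_num [abs_le])
    (fun _ _ _ _ _ _ _ => rfl) t)
  intro b hb
  simp only [Set.mem_ofPred_eq, ← Finset.mul_sum, Finset.sum_sub_distrib] at hb ⊢
  linarith

/-- Concentration of the inner product of two columns. In `b b' - g g' = g' (b - g) + b (b' - g')`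
both terms are martingale increments once the first column is revealed before the second. -/
lemma bernProb_inner_le {g : J × R → ℝ} (h0 : ∀ e, 0 ≤ g e) (h1 : ∀ e, g e ≤ 1) {y y' : R}
    (hy : y ≠ y') (t : ℝ) {lam : ℝ} (hl0 : 0 < lam) (hl1 : lam ≤ 1) {ε : ℝ} (hε : |ε| = 1) :
    bernProb g {b | t / lam + lam * ∑ i, (g (i, y') ^ 2 * g (i, y) + bval (b (i, y)) * g (i, y'))
      < ε * (∑ i, bval (b (i, y)) * bval (b (i, y')) - ∑ i, g (i, y) * g (i, y'))}
        ≤ Real.exp (-t) := by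
  have hεsq : ε ^ 2 = 1 := by rw [← sq_abs, hε, one_pow]
  have hs : ∀ f : J × R → ℝ, ∑ e ∈ Finset.univ ×ˢ {y, y'}, f e = ∑ i, (f (i, y) + f (i, y')) :=
    fun f => by
      rw [Finset.sum_product]
      exact Finset.sum_congr rfl fun i _ => Finset.sum_pair hy
  refine le_trans (bernProb_mono h0 h1 ?_) (bernProb_martingale_le h0 h1
    (fun e => if e.2 = y then 0 else 1) (Finset.univ ×ˢ {y, y'})
    (fun e b => lam * ε * if e.2 = y then g (e.1, y') else bval (b (e.1, y))) ?_ ?_ t)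
  · intro b hb
    simp only [Set.mem_ofPred_eq, hs, if_true, hy.symm, if_false] at hb ⊢
    have e1 : ∑ i, (lam * ε * g (i, y') * (bval (b (i, y)) - g (i, y))
          + lam * ε * bval (b (i, y)) * (bval (b (i, y')) - g (i, y')))
        = lam * (ε * (∑ i, bval (b (i, y)) * bval (b (i, y')) - ∑ i, g (i, y) * g (i, y'))) := by
      rw [← Finset.sum_sub_distrib, Finset.mul_sum, Finset.mul_sum]
      exact Finset.sum_congr rfl fun i _ => by ring
    have e2 : ∑ i, ((lam * ε * g (i, y')) ^ 2 * g (i, y)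
          + (lam * ε * bval (b (i, y))) ^ 2 * g (i, y'))
        = lam * (lam * ∑ i, (g (i, y') ^ 2 * g (i, y) + bval (b (i, y)) * g (i, y'))) := by
      rw [Finset.mul_sum, Finset.mul_sum]
      refine Finset.sum_congr rfl fun i _ => ?_
      have : bval (b (i, y)) ^ 2 = bval (b (i, y)) := by simp [bval]
      rw [mul_pow, mul_pow, mul_pow, mul_pow, hεsq, this]
      ring
    rw [e1, e2]
    have := mul_lt_mul_of_pos_left hb hl0
    rw [mul_add, mul_div_cancel₀ _ hl0.ne'] at this
    exact this.le
  · intro e _ b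
    rw [abs_mul, abs_mul, hε, abs_of_pos hl0, mul_one]
    refine mul_le_one₀ hl1 (abs_nonneg _) ?_
    split_ifs
    · rw [abs_of_nonneg (h0 _)]; exact h1 _
    · rw [abs_of_nonneg (bval_nonneg _)]; exact bval_le_one _
  · rintro ⟨i, r⟩ - ⟨i', r'⟩ - hle b z
    dsimp only at hle ⊢
    by_cases h : r = y
    · simp [h]
    · have h' : r' ≠ y := fun h' => by simp [h, h'] at hle
      rw [if_neg h, if_neg h, Function.update_of_ne]
      intro hc
      exact h' (Prod.ext_iff.1 hc).2.symm

/-- With high probability the top-`k` projection of a block of columns is incoherent: its diagonal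
entries are at most `8 (2 v |Y| + t) / M`, where `v` bounds the parameters and `M` is a lower bound
for the expected column sums. -/
theorem bernProb_coherent_le {g : J × R → ℝ} (h0 : ∀ e, 0 ≤ g e) {v : ℝ} (hv : v ≤ 1 / 8)
    (hg : ∀ e, g e ≤ v) (Y : Finset R) {k : ℕ} (hk : 0 < k) (hkY : k ≤ Y.card)
    {Q : (J × R → Bool) → Matrix J J ℝ}
    (hQ : ∀ b, IsTopProjection k ((bmat b).submatrix id (fun y : Y => (y : R))) (Q b))
    {M t lam : ℝ} (hM : ∀ y ∈ Y, M ≤ ∑ i, g (i, y)) (ht : 0 ≤ t) (hl0 : 0 < lam) (hl1 : lam ≤ 1)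
    (hc1 : 16 * t ≤ M) (hc2 : t ≤ v * Fintype.card J)
    (hc3 : k * (t / lam + lam * (4 * v ^ 2 * Fintype.card J)) ≤ M / 8) :
    bernProb g {b | ∃ i, 8 * (2 * v * Y.card + t) < M * Q b i i}
      ≤ (Fintype.card J + 2 * k + 2 * k ^ 2) * Real.exp (-t) := by
  classical
  have h1 : ∀ e, g e ≤ 1 := fun e => (hg e).trans (by linarith)
  obtain ⟨Y', -, hY'⟩ := Finset.exists_subset_card_eq (s := (Finset.univ : Finset Y)) (n := k)
    (by simpa using hkY)
  rcases isEmpty_or_nonempty J with hJ | ⟨⟨i₀⟩⟩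
  · have : {b : J × R → Bool | ∃ i, 8 * (2 * v * Y.card + t) < M * Q b i i} = ∅ := by
      ext b; simp
    rw [this]
    simp only [bernProb, bernExp, Set.indicator_empty, mul_zero, Finset.sum_const_zero]
    positivity
  have hv0 : 0 ≤ v := by
    have hne : Y.Nonempty := Finset.card_pos.1 (by omega)
    obtain ⟨y, -⟩ := hne
    exact (h0 (i₀, y)).trans (hg _)
  have hrow := bernProb_exists_le h0 h1 _ fun i : J =>
    bernProb_sum_upper h0 h1 (({i} : Finset J) ×ˢ Y) t
  have hcolU := bernProb_exists_le h0 h1 _ fun y : Y' =>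
    bernProb_sum_upper h0 h1 ((Finset.univ : Finset J) ×ˢ {((y : Y) : R)}) t
  have hcolL := bernProb_exists_le h0 h1 _ fun y : Y' =>
    bernProb_sum_lower h0 h1 ((Finset.univ : Finset J) ×ˢ {((y : Y) : R)}) t
  let cross : ℝ → Y' × Y' → Set (J × R → Bool) := fun ε z =>
    if ((z.1 : Y) : R) = ((z.2 : Y) : R) then ∅ else
    {b | t / lam + lam * ∑ i, (g (i, z.2) ^ 2 * g (i, z.1) + bval (b (i, z.1)) * g (i, z.2))
      < ε * (∑ i, bval (b (i, z.1)) * bval (b (i, z.2)) - ∑ i, g (i, z.1) * g (i, z.2))}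
  have hcrossle : ∀ ε : ℝ, |ε| = 1 → ∀ z, bernProb g (cross ε z) ≤ Real.exp (-t) := fun ε hε z => by
    simp only [cross]
    split_ifs with h
    · simp only [bernProb, bernExp, Set.indicator_empty, mul_zero, Finset.sum_const_zero]
      positivity
    · exact bernProb_inner_le h0 h1 h t hl0 hl1 hε
  have hcrossU := bernProb_exists_le h0 h1 _ (hcrossle 1 (by simp))
  have hcrossL := bernProb_exists_le h0 h1 _ (hcrossle (-1) (by simp))
  simp only [Finset.sum_product, Finset.sum_singleton] at hrow hcolU hcolL
  refine le_trans (bernProb_mono h0 h1 ?_) ((bernProb_union_le h0 h1 _ _).trans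
    (add_le_add hrow ((bernProb_union_le h0 h1 _ _).trans
    (add_le_add ((bernProb_union_le h0 h1 _ _).trans (add_le_add hcolU hcolL))
      ((bernProb_union_le h0 h1 _ _).trans (add_le_add hcrossU hcrossL))))) |>.trans ?_)
  · intro b hb
    by_contra hcon
    simp only [Set.mem_union, Set.mem_ofPred_eq, not_or, not_exists, not_lt] at hcon
    obtain ⟨hr, ⟨hcu, hcl⟩, hxu, hxl⟩ := hcon
    obtain ⟨i, hi⟩ := hb
    have hbsq : ∀ c : Bool, bval c ^ 2 = bval c := fun c => by simp [bval]
    have hcard : ∀ r, ∑ i : J, g (i, r) ≤ v * Fintype.card J := fun r => by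
      refine (Finset.sum_le_sum fun i _ => hg (i, r)).trans (le_of_eq ?_)
      simp [mul_comm]
    set Δ := t / lam + lam * (4 * v ^ 2 * Fintype.card J) with hΔ
    have hΔ0 : 0 ≤ Δ := by positivity
    have hgram := gram_lower_bound (A := (bmat b).submatrix id (fun y : Y => (y : R)))
      (G := Matrix.of fun i (y : Y) => g (i, (y : R))) (fun i y => hbsq _) Y' (a := M / 4) hΔ0 ?_ ?_
    · have := (hQ b).diag_le hk Y' hY' (a := M / 8) (fun w hw => le_trans ?_ (hgram w hw)) i
      · have h2 : ∑ y : Y, (bmat b).submatrix id (fun y : Y => (y : R)) i y ^ 2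
            = ∑ y ∈ Y, bval (b (i, y)) := by
          rw [← Finset.sum_coe_sort Y]
          exact Finset.sum_congr rfl fun y _ => hbsq _
        have h3 : ∑ y ∈ Y, g (i, y) ≤ v * Y.card := by
          refine (Finset.sum_le_sum fun y _ => hg (i, y)).trans (le_of_eq ?_)
          simp [mul_comm]
        have h4 := hr i
        rw [h2] at this
        linarith
      · refine mul_le_mul_of_nonneg_right ?_ (Finset.sum_nonneg fun _ _ => sq_nonneg _)
        rw [hY']
        linarith
    · intro y hy
      have h2 := hcl ⟨y, hy⟩
      have h3 : ∑ i, g (i, (y : R)) ^ 2 ≤ 1 / 8 * ∑ i, g (i, (y : R)) := by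
        rw [Finset.mul_sum]
        refine Finset.sum_le_sum fun i _ => ?_
        nlinarith [h0 (i, (y : R)), hg (i, (y : R))]
      have h4 := hM y y.2
      simp only [bmat, Matrix.submatrix_apply, Matrix.of_apply, id]
      simp only at h2
      linarith
    · intro y hy y' hy' hne
      have hne' : (y : R) ≠ y' := fun h => hne (Subtype.ext h)
      have hbound : t / lam + lam * ∑ i, (g (i, (y' : R)) ^ 2 * g (i, (y : R))
          + bval (b (i, (y : R))) * g (i, (y' : R))) ≤ Δ := by
        have h2 : ∑ i, (g (i, (y' : R)) ^ 2 * g (i, (y : R))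
            + bval (b (i, (y : R))) * g (i, (y' : R))) ≤ 4 * v ^ 2 * Fintype.card J := by
          have h3 : ∀ i, g (i, (y' : R)) ^ 2 * g (i, (y : R))
              + bval (b (i, (y : R))) * g (i, (y' : R)) ≤ v ^ 2 + bval (b (i, (y : R))) * v := by
            intro i
            have h5 := pow_le_pow_left₀ (h0 (i, (y' : R))) (hg (i, (y' : R))) 2
            have h6 := mul_le_mul_of_nonneg_left (hg (i, (y' : R))) (bval_nonneg (b (i, (y : R))))
            nlinarith [h0 (i, (y : R)), h1 (i, (y : R)), sq_nonneg (g (i, (y' : R)))]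
          refine (Finset.sum_le_sum fun i _ => h3 i).trans ?_
          rw [Finset.sum_add_distrib, ← Finset.sum_mul]
          have h4 := hcu ⟨y, hy⟩
          have h5 := hcard (y : R)
          simp only [Finset.sum_const, Finset.card_univ, nsmul_eq_mul]
          simp only at h4
          nlinarith
        rw [hΔ]
        gcongr
      have h2 := hxu (⟨y, hy⟩, ⟨y', hy'⟩)
      have h3 := hxl (⟨y, hy⟩, ⟨y', hy'⟩)
      simp only [cross, hne', if_false, Set.mem_ofPred_eq, not_lt] at h2 h3
      simp only [bmat, Matrix.submatrix_apply, Matrix.of_apply, id]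
      rw [abs_le]
      constructor <;> linarith
  · apply le_of_eq
    simp only [Fintype.card_prod, Fintype.card_coe, hY']
    push_cast
    ring

end Incoherence

/-! ### The conditional law of the adjacency array given the memberships -/

lemma real_inter_eq_setIntegral_condExp {Ω : Type*} {m mΩ : MeasurableSpace Ω} {μ : Measure Ω}
    [IsFiniteMeasure μ] (hm : m ≤ mΩ) {A B : Set Ω} (hA : MeasurableSet[m] A)
    (hB : MeasurableSet B) : μ.real (A ∩ B) = ∫ ω in A, (μ⟦B | m⟧) ω ∂μ := by
  rw [setIntegral_condExp hm ((integrable_const (1 : ℝ)).indicator hB) hA,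
    setIntegral_indicator hB]
  simp

section Parameters

variable {U T R : Type} {k : ℕ}

/-- The mean of an entry of the hyper-adjacency matrix given the memberships `π`. -/
def param (P Pt : Matrix (Fin k) (Fin k) ℝ) (π : U ⊕ T ⊕ R → Fin k → ℝ) (e : (U × T) × R) : ℝ :=
  ∑ c, π (Sum.inr (Sum.inr e.2)) c *
    ((∑ a, π (Sum.inl e.1.1) a * P a c) * ∑ b, π (Sum.inr (Sum.inl e.1.2)) b * Pt b c)

variable {P Pt : Matrix (Fin k) (Fin k) ℝ} {π : U ⊕ T ⊕ R → Fin k → ℝ}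

lemma sum_mul_nonneg_of_mem_stdSimplex {x y : Fin k → ℝ} (hx : x ∈ stdSimplex ℝ (Fin k))
    (hy : ∀ a, 0 ≤ y a) : 0 ≤ ∑ a, x a * y a :=
  Finset.sum_nonneg fun a _ => mul_nonneg (hx.1 a) (hy a)

lemma sum_mul_le_of_mem_stdSimplex {x y : Fin k → ℝ} (hx : x ∈ stdSimplex ℝ (Fin k)) {p : ℝ}
    (hy : ∀ a, y a ≤ p) : ∑ a, x a * y a ≤ p := by
  calc ∑ a, x a * y a ≤ ∑ a, x a * p :=
        Finset.sum_le_sum fun a _ => mul_le_mul_of_nonneg_left (hy a) (hx.1 a)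
    _ = p := by rw [← Finset.sum_mul, hx.2, one_mul]

lemma param_nonneg (hπ : ∀ i, π i ∈ stdSimplex ℝ (Fin k)) (hP : ∀ a c, 0 ≤ P a c)
    (hPt : ∀ a c, 0 ≤ Pt a c) (e : (U × T) × R) : 0 ≤ param P Pt π e :=
  sum_mul_nonneg_of_mem_stdSimplex (hπ _) fun c => mul_nonneg
    (sum_mul_nonneg_of_mem_stdSimplex (hπ _) fun a => hP a c)
    (sum_mul_nonneg_of_mem_stdSimplex (hπ _) fun b => hPt b c)

lemma param_le (hπ : ∀ i, π i ∈ stdSimplex ℝ (Fin k)) {p : ℝ} (hP : ∀ a c, 0 ≤ P a c)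
    (hPt : ∀ a c, 0 ≤ Pt a c) (hPp : ∀ a c, P a c ≤ p) (hPtp : ∀ a c, Pt a c ≤ p)
    (e : (U × T) × R) : param P Pt π e ≤ p ^ 2 := by
  refine sum_mul_le_of_mem_stdSimplex (hπ _) fun c => ?_
  rw [sq]
  have h1 := sum_mul_nonneg_of_mem_stdSimplex (hπ (Sum.inl e.1.1)) fun a => hP a c
  have h2 := sum_mul_le_of_mem_stdSimplex (hπ (Sum.inl e.1.1)) fun a => hPp a c
  exact mul_le_mul h2 (sum_mul_le_of_mem_stdSimplex (hπ _) fun b => hPtp b c)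
    (sum_mul_nonneg_of_mem_stdSimplex (hπ _) fun b => hPt b c) (h1.trans h2)

lemma measurable_param (e : (U × T) × R) :
    Measurable fun π : U ⊕ T ⊕ R → Fin k → ℝ => param P Pt π e := by
  unfold param
  fun_prop

/-- The values of the contexts of the user, the tag and the resource, and of the two edge variables
of a triplet. -/
abbrev Local (k : ℕ) := (Fin k × Fin k × Fin k) × Bool × Bool

/-- Conditional probability, given the memberships, that a triplet takes the local values `z`. -/
def localWeight (P Pt : Matrix (Fin k) (Fin k) ℝ) (π : U ⊕ T ⊕ R → Fin k → ℝ) (e : (U × T) × R)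
    (z : Local k) : ℝ :=
  (bernWeight (P z.1.1 z.1.2.2) z.2.1 * bernWeight (Pt z.1.2.1 z.1.2.2) z.2.2) *
    (π (Sum.inl e.1.1) z.1.1 * π (Sum.inr (Sum.inl e.1.2)) z.1.2.1 *
      π (Sum.inr (Sum.inr e.2)) z.1.2.2)

/-- The product of the two edge variables of a triplet is Bernoulli with parameter `param`. -/
lemma sum_localWeight (hπ : ∀ i, π i ∈ stdSimplex ℝ (Fin k)) (e : (U × T) × R) (β : Bool) :
    ∑ z : Local k, (if (z.2.1 && z.2.2) = β then localWeight P Pt π e z else 0)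
      = bernWeight (param P Pt π e) β := by
  have hbool : ∀ x y : ℝ, ∑ w : Bool × Bool,
      (if (w.1 && w.2) = β then bernWeight x w.1 * bernWeight y w.2 else 0)
        = bernWeight (x * y) β := fun x y => by
    simp only [Fintype.sum_prod_type, Fintype.sum_bool]
    cases β <;> simp [bernWeight]
    ring
  have h1 : ∑ z : Local k, (if (z.2.1 && z.2.2) = β then localWeight P Pt π e z else 0)
      = ∑ a, ∑ b, ∑ c, bernWeight (P a c * Pt b c) β * (π (Sum.inl e.1.1) a *
        π (Sum.inr (Sum.inl e.1.2)) b * π (Sum.inr (Sum.inr e.2)) c) := by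
    rw [Fintype.sum_prod_type, Fintype.sum_prod_type]
    simp only [Fintype.sum_prod_type (α₁ := Fin k) (α₂ := Fin k)]
    refine Finset.sum_congr rfl fun a _ => Finset.sum_congr rfl fun b _ =>
      Finset.sum_congr rfl fun c _ => ?_
    rw [← hbool, Finset.sum_mul]
    refine Finset.sum_congr rfl fun w _ => ?_
    simp only [localWeight, ite_mul, zero_mul]
  have hp : ∑ a, ∑ b, ∑ c, P a c * Pt b c * (π (Sum.inl e.1.1) a *
      π (Sum.inr (Sum.inl e.1.2)) b * π (Sum.inr (Sum.inr e.2)) c) = param P Pt π e := by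
    rw [Finset.sum_congr rfl fun a _ => Finset.sum_comm, Finset.sum_comm, param]
    refine Finset.sum_congr rfl fun c _ => ?_
    rw [Finset.sum_mul_sum, Finset.mul_sum]
    refine Finset.sum_congr rfl fun a _ => ?_
    rw [Finset.mul_sum]
    exact Finset.sum_congr rfl fun b _ => by ring
  have hone : ∑ a, ∑ b, ∑ c, (π (Sum.inl e.1.1) a *
      π (Sum.inr (Sum.inl e.1.2)) b * π (Sum.inr (Sum.inr e.2)) c) = 1 := by
    simp only [← Finset.mul_sum, (hπ _).2, mul_one]
  rw [h1]
  cases β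
  · simp only [bernWeight, Bool.false_eq_true, if_false, sub_mul, one_mul,
      Finset.sum_sub_distrib, hone, hp]
  · simp only [bernWeight, if_true, hp]

end Parameters

namespace Model

variable {Ω : Type*} [mΩ : MeasurableSpace Ω] {μ : Measure Ω}
  {U T R : Type} [Fintype U] [Fintype T] [Fintype R] {k : ℕ}
  {ν : Measure (Fin k → ℝ)} {P Pt : Matrix (Fin k) (Fin k) ℝ}

/-- The Boolean array underlying the hyper-adjacency matrix. -/
def hit (S : Model μ U T R k ν P Pt) (ω : Ω) (e : (U × T) × R) : Bool :=
  S.edgeU e.1.1 e.1.2 e.2 ω && S.edgeT e.1.1 e.1.2 e.2 ω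

/-- All memberships at once. -/
def members (S : Model μ U T R k ν P Pt) (ω : Ω) (i : U ⊕ T ⊕ R) : Fin k → ℝ := S.member i ω

/-- The local values of all triplets at once. -/
def locals (S : Model μ U T R k ν P Pt) (ω : Ω) (e : (U × T) × R) : Local k :=
  ((S.ctxU e.1.1 e.1.2 e.2 ω, S.ctxT e.1.1 e.1.2 e.2 ω, S.ctxR e.1.1 e.1.2 e.2 ω),
    S.edgeU e.1.1 e.1.2 e.2 ω, S.edgeT e.1.1 e.1.2 e.2 ω)

variable (S : Model μ U T R k ν P Pt)

lemma adj_eq (ω : Ω) : S.adj ω = bmat (S.hit ω) := by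
  ext ut r
  simp only [adj, bmat, hit, bval, Matrix.of_apply]
  by_cases h1 : S.edgeU ut.1 ut.2 r ω = true <;> by_cases h2 : S.edgeT ut.1 ut.2 r ω = true <;>
    simp [h1, h2]

lemma measurable_members : Measurable S.members := measurable_pi_lambda _ S.measurable_member

lemma measurable_locals : Measurable S.locals :=
  measurable_pi_lambda _ fun _ =>
    ((S.measurable_ctxU _ _ _).prodMk ((S.measurable_ctxT _ _ _).prodMk
      (S.measurable_ctxR _ _ _))).prodMk
        ((S.measurable_edgeU _ _ _).prodMk (S.measurable_edgeT _ _ _))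

lemma measurable_hit : Measurable S.hit :=
  measurable_pi_lambda _ fun _ =>
    (measurable_of_finite fun w : Bool × Bool => w.1 && w.2).comp
      ((S.measurable_edgeU _ _ _).prodMk (S.measurable_edgeT _ _ _))

lemma sigmaMember_le : S.sigmaMember ≤ mΩ := S.measurable_members.comap_le

lemma ae_mem_stdSimplex (hν : ∀ᵐ x ∂ν, x ∈ stdSimplex ℝ (Fin k)) :
    ∀ᵐ ω ∂μ, ∀ i, S.members ω i ∈ stdSimplex ℝ (Fin k) := by
  refine ae_all_iff.2 fun i => ?_
  rw [← S.law_member i] at hν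
  exact ae_of_ae_map (S.measurable_member i).aemeasurable hν

variable [IsProbabilityMeasure μ]

/-- Joint law of the memberships and of the local values of all triplets. -/
lemma real_members_locals {D : Set (U ⊕ T ⊕ R → Fin k → ℝ)} (hD : MeasurableSet D)
    (z : (U × T) × R → Local k) :
    IntegrableOn (fun ω => ∏ e, localWeight P Pt (S.members ω) e (z e)) (S.members ⁻¹' D) μ ∧
    μ.real (S.members ⁻¹' D ∩ S.locals ⁻¹' {z})
      = ∫ ω in S.members ⁻¹' D, ∏ e, localWeight P Pt (S.members ω) e (z e) ∂μ := by
  let C : Set Ω := {ω | ∀ u t r, S.ctxU u t r ω = (z ((u, t), r)).1.1 ∧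
    S.ctxT u t r ω = (z ((u, t), r)).1.2.1 ∧ S.ctxR u t r ω = (z ((u, t), r)).1.2.2}
  let F : Set Ω := {ω | ∀ u t r, S.edgeU u t r ω = (z ((u, t), r)).2.1 ∧
    S.edgeT u t r ω = (z ((u, t), r)).2.2}
  have hC := S.law_ctx (fun u t r => (z ((u, t), r)).1.1) (fun u t r => (z ((u, t), r)).1.2.1)
    (fun u t r => (z ((u, t), r)).1.2.2)
  have hF := S.law_edge (fun u t r => (z ((u, t), r)).2.1) (fun u t r => (z ((u, t), r)).2.2)
  have hCm : MeasurableSet C := by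
    simp only [C, Set.ofPred_forall, Set.ofPred_and]
    refine .iInter fun u => .iInter fun t => .iInter fun r => ?_
    exact ((S.measurable_ctxU u t r) (measurableSet_singleton _)).inter
      (((S.measurable_ctxT u t r) (measurableSet_singleton _)).inter
        ((S.measurable_ctxR u t r) (measurableSet_singleton _)))
  have hFm : MeasurableSet F := by
    simp only [F, Set.ofPred_forall, Set.ofPred_and]
    refine .iInter fun u => .iInter fun t => .iInter fun r => ?_
    exact ((S.measurable_edgeU u t r) (measurableSet_singleton _)).inter
      ((S.measurable_edgeT u t r) (measurableSet_singleton _))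
  let ctx : Ω → (U ⊕ T ⊕ R → Fin k → ℝ) × (U → T → R → Fin k × Fin k × Fin k) := fun ω =>
    ((fun i => S.member i ω), (fun u t r => (S.ctxU u t r ω, S.ctxT u t r ω, S.ctxR u t r ω)))
  have hctx : Measurable ctx :=
    S.measurable_members.prodMk (measurable_pi_lambda _ fun u => measurable_pi_lambda _ fun t =>
      measurable_pi_lambda _ fun r => (S.measurable_ctxU u t r).prodMk
        ((S.measurable_ctxT u t r).prodMk (S.measurable_ctxR u t r)))
  have hm₂ : MeasurableSpace.comap ctx inferInstance ≤ mΩ := hctx.comap_le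
  have hD₁ : MeasurableSet[S.sigmaMember] (S.members ⁻¹' D) := ⟨D, hD, rfl⟩
  have hDC : MeasurableSet[MeasurableSpace.comap ctx inferInstance] (S.members ⁻¹' D ∩ C) := by
    refine ⟨D ×ˢ {fun u t r => (z ((u, t), r)).1}, hD.prod (measurableSet_singleton _), ?_⟩
    ext ω
    simp only [Set.mem_preimage, Set.mem_prod, Set.mem_singleton_iff, funext_iff, ctx, C,
      Set.mem_inter_iff, Prod.ext_iff]
    rfl
  let κ : ℝ := ∏ u, ∏ t, ∏ r,
    bernWeight (P (z ((u, t), r)).1.1 (z ((u, t), r)).1.2.2) (z ((u, t), r)).2.1 *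
      bernWeight (Pt (z ((u, t), r)).1.2.1 (z ((u, t), r)).1.2.2) (z ((u, t), r)).2.2
  have hset : S.members ⁻¹' D ∩ S.locals ⁻¹' {z} = (S.members ⁻¹' D ∩ C) ∩ F := by
    ext ω
    simp only [Set.mem_inter_iff, Set.mem_preimage, Set.mem_singleton_iff, funext_iff, locals,
      Prod.ext_iff, Prod.forall, C, F, Set.mem_ofPred_eq, and_assoc]
    constructor
    · rintro ⟨h1, h2⟩
      exact ⟨h1, fun u t r => ⟨(h2 u t r).1, (h2 u t r).2.1, (h2 u t r).2.2.1⟩,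
        fun u t r => (h2 u t r).2.2.2⟩
    · rintro ⟨h1, h2, h3⟩
      exact ⟨h1, fun u t r => ⟨(h2 u t r).1, (h2 u t r).2.1, (h2 u t r).2.2, h3 u t r⟩⟩
  have hprod : ∀ ω, ∏ e, localWeight P Pt (S.members ω) e (z e)
      = κ * ∏ u, ∏ t, ∏ r, S.member (Sum.inl u) ω (z ((u, t), r)).1.1 *
        S.member (Sum.inr (Sum.inl t)) ω (z ((u, t), r)).1.2.1 *
          S.member (Sum.inr (Sum.inr r)) ω (z ((u, t), r)).1.2.2 := fun ω => by
    simp only [κ, Fintype.prod_prod_type, localWeight, Finset.prod_mul_distrib, members]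
  have h1 : μ.real ((S.members ⁻¹' D ∩ C) ∩ F) = κ * μ.real (S.members ⁻¹' D ∩ C) := by
    rw [real_inter_eq_setIntegral_condExp hm₂ hDC hFm,
      setIntegral_congr_ae (g := fun _ => κ) (hm₂ _ hDC)]
    · simp [mul_comm]
    · filter_upwards [hF] with ω hω hmem
      refine hω.trans ?_
      refine Finset.prod_congr rfl fun u _ => Finset.prod_congr rfl fun t _ =>
        Finset.prod_congr rfl fun r _ => ?_
      obtain ⟨e1, e2, e3⟩ := hmem.2 u t r
      rw [e1, e2, e3]
  constructor
  · simp only [hprod]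
    exact ((integrable_condExp.congr hC).const_mul κ).integrableOn
  · rw [hset, h1, real_inter_eq_setIntegral_condExp S.sigmaMember_le hD₁ hCm]
    simp only [hprod]
    rw [integral_const_mul, setIntegral_congr_ae (S.sigmaMember_le _ hD₁)
      (hC.mono fun ω hω _ => hω)]

/-- Given the memberships, the entries of the hyper-adjacency matrix are independent Bernoulli
variables with parameters `param`. -/
theorem real_members_hit [DecidableEq U] [DecidableEq T] [DecidableEq R]
    (hν : ∀ᵐ x ∂ν, x ∈ stdSimplex ℝ (Fin k))
    {D : Set (U ⊕ T ⊕ R → Fin k → ℝ)} (hD : MeasurableSet D) (β : (U × T) × R → Bool) :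
    IntegrableOn (fun ω => bernMass (param P Pt (S.members ω)) β) (S.members ⁻¹' D) μ ∧
    μ.real (S.members ⁻¹' D ∩ S.hit ⁻¹' {β})
      = ∫ ω in S.members ⁻¹' D, bernMass (param P Pt (S.members ω)) β ∂μ := by
  classical
  let s : Finset ((U × T) × R → Local k) := {z | ∀ e, ((z e).2.1 && (z e).2.2) = β e}
  have hDm : MeasurableSet (S.members ⁻¹' D) := S.measurable_members hD
  have hae : (fun ω => ∑ z ∈ s, ∏ e, localWeight P Pt (S.members ω) e (z e))
      =ᵐ[μ] fun ω => bernMass (param P Pt (S.members ω)) β := by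
    filter_upwards [S.ae_mem_stdSimplex hν] with ω hω
    simp only [bernMass]
    rw [Finset.prod_congr rfl fun e _ => (sum_localWeight hω e (β e)).symm, Fintype.prod_sum,
      Finset.sum_filter]
    refine Finset.sum_congr rfl fun z _ => ?_
    rw [Finset.prod_ite_zero]
    simp
  have hint : IntegrableOn (fun ω => ∑ z ∈ s, ∏ e, localWeight P Pt (S.members ω) e (z e))
      (S.members ⁻¹' D) μ :=
    integrable_finsetSum _ fun z _ => (S.real_members_locals hD z).1
  refine ⟨hint.congr (ae_restrict_of_ae hae), ?_⟩
  have hset : S.hit ⁻¹' {β} = S.locals ⁻¹' s := by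
    ext ω
    simp [s, hit, locals, funext_iff]
  have hmeas : ∀ z ∈ s, MeasurableSet (S.locals ⁻¹' {z}) := fun z _ =>
    S.measurable_locals (measurableSet_singleton z)
  rw [← setIntegral_congr_ae hDm (hae.mono fun ω hω _ => hω),
    integral_finsetSum _ fun z _ => (S.real_members_locals hD z).1, hset]
  have h1 := sum_measureReal_preimage_singleton (μ := μ.restrict (S.members ⁻¹' D)) s hmeas
  rw [measureReal_restrict_apply (S.measurable_locals s.measurableSet), Set.inter_comm] at h1
  rw [← h1]
  refine Finset.sum_congr rfl fun z hz => ?_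
  rw [← (S.real_members_locals hD z).2, measureReal_restrict_apply (hmeas z hz), Set.inter_comm]

end Model

/-! ### Exact moments, community sizes and the second moment matrix -/

/-- The marginals of a product of Bernoulli laws. -/
lemma bernProb_coord {ι : Type*} [Fintype ι] [DecidableEq ι] (g : ι → ℝ) (i : ι) :
    bernProb g {b | b i = true} = g i := by
  rw [bernProb, ← bernExp_resample g i]
  refine Eq.trans ?_ (bernExp_const g (g i))
  congr 1
  ext b
  simp [bernWeight, Set.indicator]

/-- Lower tail of a sum of independent variables with values in `[0, 1]` and mean `a`. -/
lemma real_sum_le_le_exp {Ω κ : Type*} [MeasurableSpace Ω] {μ : Measure Ω}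
    [IsProbabilityMeasure μ] [Fintype κ] {X : κ → Ω → ℝ} (hX : iIndepFun X μ)
    (hm : ∀ j, Measurable (X j)) (h01 : ∀ j, ∀ᵐ ω ∂μ, X j ω ∈ Set.Icc 0 1) {a : ℝ}
    (ha : ∀ j, ∫ ω, X j ω ∂μ = a) :
    μ.real {ω | ∑ j, X j ω ≤ Fintype.card κ * a / 4} ≤ Real.exp (-(Fintype.card κ * a / 4)) := by
  have hint : ∀ j, Integrable (X j) μ := fun j =>
    Integrable.of_bound (hm j).aestronglyMeasurable 1 ((h01 j).mono fun ω h => by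
      rw [Real.norm_eq_abs, abs_of_nonneg h.1]; exact h.2)
  have hmgf : ∀ j, mgf (X j) μ (-1) ≤ Real.exp (-(a / 2)) := fun j => by
    have h1 : mgf (X j) μ (-1) ≤ ∫ ω, (1 - X j ω / 2) ∂μ := by
      refine integral_mono_ae ?_ ((integrable_const _).sub ((hint j).div_const 2)) ?_
      · refine Integrable.of_bound (by fun_prop) 1 ((h01 j).mono fun ω h => ?_)
        rw [Real.norm_eq_abs, abs_of_pos (Real.exp_pos _), Real.exp_le_one_iff]
        linarith [h.1]
      · filter_upwards [h01 j] with ω h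
        have h2 := (abs_le.1 (Real.abs_exp_sub_one_sub_id_le (x := -X j ω)
          (by rw [abs_neg, abs_of_nonneg h.1]; exact h.2))).2
        have h3 : Real.exp (-X j ω) * Real.exp (X j ω) = 1 := by rw [← Real.exp_add]; simp
        have h4 := Real.quadratic_le_exp_of_nonneg h.1
        have h5 := Real.exp_pos (-X j ω)
        have h6 : 1 ≤ (1 - X j ω / 2) * (1 + X j ω + X j ω ^ 2 / 2) := by
          nlinarith [h.1, h.2, mul_nonneg h.1 h.1,
            mul_nonneg (mul_nonneg h.1 h.1) (sub_nonneg.2 h.2)]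
        show Real.exp (-1 * X j ω) ≤ 1 - X j ω / 2
        rw [neg_one_mul]
        have h7 : 0 ≤ 1 - X j ω / 2 := by linarith [h.2]
        have h8 := mul_le_mul_of_nonneg_left h4 h7
        nlinarith [mul_le_mul_of_nonneg_left (h6.trans h8) h5.le]
    rw [integral_sub (integrable_const _) ((hint j).div_const 2), integral_div, ha] at h1
    have h2 := Real.add_one_le_exp (-(a / 2))
    simp only [integral_const, probReal_univ, smul_eq_mul, mul_one] at h1
    linarith
  have hsum : ∀ ω, (∑ j, X j) ω = ∑ j, X j ω := fun ω => Finset.sum_apply _ _ _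
  have h1 := measure_le_le_exp_mul_mgf (μ := μ) (X := ∑ j, X j) (t := -1)
    (Fintype.card κ * a / 4) (by norm_num) (by
      refine Integrable.of_bound (by
        have : Measurable (∑ j, X j) := by
          rw [show ∑ j, X j = fun ω => ∑ j, X j ω from funext hsum]
          exact Finset.measurable_sum _ fun j _ => hm j
        fun_prop) 1 ((ae_all_iff.2 h01).mono fun ω h => ?_)
      rw [Real.norm_eq_abs, abs_of_pos (Real.exp_pos _), Real.exp_le_one_iff, hsum]
      have := Finset.sum_nonneg fun j (_ : j ∈ Finset.univ) => (h j).1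
      linarith)
  rw [hX.mgf_sum hm] at h1
  simp only [hsum] at h1
  refine h1.trans ?_
  have h2 : ∏ j, mgf (X j) μ (-1) ≤ Real.exp (-(a / 2)) ^ Fintype.card κ := by
    refine (Finset.prod_le_prod (fun j _ => mgf_nonneg) fun j _ => hmgf j).trans (le_of_eq ?_)
    rw [Finset.prod_const, Finset.card_univ]
  refine (mul_le_mul_of_nonneg_left h2 (Real.exp_pos _).le).trans (le_of_eq ?_)
  rw [← Real.exp_nat_mul, ← Real.exp_add]
  congr 1
  ring

section SecondMoment

lemma singularValues_mul_norm_le {E F : Type*} [NormedAddCommGroup E] [InnerProductSpace ℝ E]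
    [FiniteDimensional ℝ E] [NormedAddCommGroup F] [InnerProductSpace ℝ F]
    [FiniteDimensional ℝ F] (T : E →ₗ[ℝ] F) {d : ℕ} (hd : Module.finrank ℝ E = d) (hd0 : 0 < d)
    (x : E) : T.singularValues (d - 1) * ‖x‖ ≤ ‖T x‖ := by
  let hT := T.isSymmetric_adjoint_comp_self
  have hlast : ∀ i : Fin d, T.singularValues (d - 1) ^ 2 ≤ hT.eigenvalues hd i := fun i => by
    rw [← T.sq_singularValues_fin hd i]
    exact pow_le_pow_left₀ (T.singularValues_nonneg _) (T.singularValues_antitone (by omega)) 2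
  have h1 : ‖T x‖ ^ 2 = ∑ i, hT.eigenvalues hd i * inner ℝ (hT.eigenvectorBasis hd i) x ^ 2 := by
    rw [← real_inner_self_eq_norm_sq, ← LinearMap.adjoint_inner_left,
      ← (hT.eigenvectorBasis hd).sum_inner_mul_inner]
    refine Finset.sum_congr rfl fun i _ => ?_
    have h2 : inner ℝ (LinearMap.adjoint T (T x)) (hT.eigenvectorBasis hd i)
        = hT.eigenvalues hd i * inner ℝ (hT.eigenvectorBasis hd i) x := by
      have := hT x (hT.eigenvectorBasis hd i)
      rw [hT.apply_eigenvectorBasis hd i, inner_smul_right] at this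
      rw [real_inner_comm x (hT.eigenvectorBasis hd i)]
      simpa using this
    rw [h2]
    ring
  have h2 : ‖x‖ ^ 2 = ∑ i, inner ℝ (hT.eigenvectorBasis hd i) x ^ 2 := by
    rw [← (hT.eigenvectorBasis hd).sum_sq_norm_inner_right x]
    simp
  refine abs_le_of_sq_le_sq' ?_ (norm_nonneg _) |>.2
  rw [mul_pow, h1, h2, Finset.mul_sum]
  exact Finset.sum_le_sum fun i _ => mul_le_mul_of_nonneg_right (hlast i) (sq_nonneg _)

/-- The all-ones vector is an eigenvector of the second moment matrix, with eigenvalue `1 / k`. -/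
lemma sigmaMin_secondMoment_le {k : ℕ} (hk : 0 < k) {ν : Measure (Fin k → ℝ)}
    [IsProbabilityMeasure ν] (hν : ∀ᵐ x ∂ν, x ∈ stdSimplex ℝ (Fin k))
    (hmean : ∀ i, ∫ x, x i ∂ν = 1 / k) : sigmaMin (secondMoment ν) ≤ 1 / k := by
  let one : EuclideanSpace ℝ (Fin k) := WithLp.toLp 2 fun _ => (1 : ℝ)
  have hint : ∀ i j, Integrable (fun x : Fin k → ℝ => x i * x j) ν := fun i j =>
    Integrable.of_bound (by fun_prop) 1 (hν.mono fun x hx => by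
      have h1 := mem_Icc_of_mem_stdSimplex hx i
      have h2 := mem_Icc_of_mem_stdSimplex hx j
      rw [Real.norm_eq_abs, abs_of_nonneg (mul_nonneg h1.1 h2.1)]
      exact mul_le_one₀ h1.2 h2.1 h2.2)
  have hone : Matrix.toEuclideanLin (secondMoment ν) one = (1 / (k : ℝ)) • one := by
    ext i
    simp only [one, Matrix.toLpLin_apply, Matrix.mulVec, dotProduct, secondMoment,
      Matrix.of_apply, mul_one, PiLp.smul_apply, smul_eq_mul]
    rw [← integral_finsetSum _ fun j _ => hint i j, ← hmean i]
    refine integral_congr_ae (hν.mono fun x hx => ?_)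
    simp only [← Finset.mul_sum, hx.2, mul_one]
  have hpos : 0 < ‖one‖ := by
    rw [norm_pos_iff]
    intro h
    have := congrArg (fun v : EuclideanSpace ℝ (Fin k) => v ⟨0, hk⟩) h
    simp [one] at this
  have h1 := singularValues_mul_norm_le (Matrix.toEuclideanLin (secondMoment ν)) (d := k)
    (by simp) hk one
  rw [hone, norm_smul, Real.norm_of_nonneg (by positivity)] at h1
  exact le_of_mul_le_mul_right h1 hpos

end SecondMoment

section Homogeneous

variable {k : ℕ} {p q : ℝ}

lemma homogeneous_apply (a c : Fin k) :
    homogeneous k p q a c = if a = c then p else q := by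
  by_cases h : a = c <;> simp [homogeneous, h]

lemma homogeneous_nonneg (hq : 0 ≤ q) (hqp : q < p) (a c : Fin k) : 0 ≤ homogeneous k p q a c := by
  rw [homogeneous_apply]; split_ifs <;> linarith

lemma homogeneous_le (hqp : q < p) (a c : Fin k) : homogeneous k p q a c ≤ p := by
  rw [homogeneous_apply]; split_ifs <;> linarith

lemma mul_le_sum_homogeneous (hq : 0 ≤ q) (hqp : q < p) {x : Fin k → ℝ}
    (hx : x ∈ stdSimplex ℝ (Fin k)) (c : Fin k) :
    p * x c ≤ ∑ a, x a * homogeneous k p q a c := by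
  refine le_trans (le_of_eq ?_) (Finset.single_le_sum
    (fun a _ => mul_nonneg (hx.1 a) (homogeneous_nonneg hq hqp a c)) (Finset.mem_univ c))
  rw [homogeneous_apply, if_pos rfl, mul_comm]

/-- If every community has total weight at least `s` among the users and at least `s'` among the
tags, then the expected degree of every resource is at least `p² s s'`. -/
lemma le_sum_param {U T R : Type} [Fintype U] [Fintype T] (hq : 0 ≤ q) (hqp : q < p)
    {π : U ⊕ T ⊕ R → Fin k → ℝ} (hπ : ∀ i, π i ∈ stdSimplex ℝ (Fin k)) {s s' : ℝ}
    (hs0 : 0 ≤ s) (hs : ∀ c, s ≤ ∑ u, π (Sum.inl u) c) (hs0' : 0 ≤ s')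
    (hs' : ∀ c, s' ≤ ∑ t, π (Sum.inr (Sum.inl t)) c) (r : R) :
    p ^ 2 * s * s' ≤ ∑ i : U × T, param (homogeneous k p q) (homogeneous k p q) π (i, r) := by
  have hp : 0 ≤ p := hq.trans hqp.le
  have hsum : ∑ i : U × T, param (homogeneous k p q) (homogeneous k p q) π (i, r)
      = ∑ c, π (Sum.inr (Sum.inr r)) c *
        ((∑ u, ∑ a, π (Sum.inl u) a * homogeneous k p q a c) *
          ∑ t, ∑ b, π (Sum.inr (Sum.inl t)) b * homogeneous k p q b c) := by
    simp only [param]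
    rw [Finset.sum_comm]
    refine Finset.sum_congr rfl fun c _ => ?_
    rw [← Finset.mul_sum, Fintype.sum_prod_type, Finset.sum_mul_sum]
  rw [hsum]
  have hb : ∀ c, p ^ 2 * s * s' ≤ (∑ u, ∑ a, π (Sum.inl u) a * homogeneous k p q a c) *
      ∑ t, ∑ b, π (Sum.inr (Sum.inl t)) b * homogeneous k p q b c := fun c => by
    have h1 : p * s ≤ ∑ u, ∑ a, π (Sum.inl u) a * homogeneous k p q a c := by
      refine (mul_le_mul_of_nonneg_left (hs c) hp).trans ?_
      rw [Finset.mul_sum]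
      exact Finset.sum_le_sum fun u _ => mul_le_sum_homogeneous hq hqp (hπ _) c
    have h2 : p * s' ≤ ∑ t, ∑ b, π (Sum.inr (Sum.inl t)) b * homogeneous k p q b c := by
      refine (mul_le_mul_of_nonneg_left (hs' c) hp).trans ?_
      rw [Finset.mul_sum]
      exact Finset.sum_le_sum fun t _ => mul_le_sum_homogeneous hq hqp (hπ _) c
    have h3 := mul_le_mul h1 h2 (by positivity) ((by positivity : 0 ≤ p * s).trans h1)
    linarith [show p * s * (p * s') = p ^ 2 * s * s' by ring]
  calc p ^ 2 * s * s' = ∑ c, π (Sum.inr (Sum.inr r)) c * (p ^ 2 * s * s') := by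
        rw [← Finset.sum_mul, (hπ _).2, one_mul]
    _ ≤ _ := Finset.sum_le_sum fun c _ => mul_le_mul_of_nonneg_left (hb c) ((hπ _).1 c)

end Homogeneous

namespace Model

variable {Ω : Type*} [mΩ : MeasurableSpace Ω] {μ : Measure Ω} [IsProbabilityMeasure μ]
  {U T R : Type} [Fintype U] [Fintype T] [Fintype R] {k : ℕ} {ν : Measure (Fin k → ℝ)}
  {P Pt : Matrix (Fin k) (Fin k) ℝ} (S : Model μ U T R k ν P Pt)

/-- Every community has its share of total weight among any family of distinct nodes. -/
theorem real_sum_members_le (hν : ∀ᵐ x ∂ν, x ∈ stdSimplex ℝ (Fin k))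
    (hmean : ∀ i, ∫ x, x i ∂ν = 1 / k) {κ : Type*} [Fintype κ] {f : κ → U ⊕ T ⊕ R}
    (hf : Function.Injective f) (c : Fin k) :
    μ.real {ω | ∑ j, S.members ω (f j) c ≤ Fintype.card κ / (4 * k)}
      ≤ Real.exp (-(Fintype.card κ / (4 * k))) := by
  have h := real_sum_le_le_exp (X := fun j ω => S.members ω (f j) c) (a := 1 / k)
    ((S.indep_member.precomp hf).comp (fun _ x => x c) fun _ => measurable_pi_apply c)
    (fun j => (measurable_pi_apply c).comp (S.measurable_member (f j)))
    (fun j => (S.ae_mem_stdSimplex hν).mono fun ω hω => mem_Icc_of_mem_stdSimplex (hω _) c)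
    (fun j => by
      have h2 := integral_map (μ := μ) (S.measurable_member (f j)).aemeasurable
        (f := fun x => x c) (measurable_pi_apply c).aestronglyMeasurable
      rw [S.law_member, hmean c] at h2
      exact h2.symm)
  have e : (Fintype.card κ : ℝ) * (1 / k) / 4 = Fintype.card κ / (4 * k) := by
    rw [mul_one_div, div_div, mul_comm (k : ℝ)]
  rwa [e] at h

variable [DecidableEq U] [DecidableEq T] [DecidableEq R]

/-- The joint probability of an event in the memberships and in the adjacency array is at most a
bound on its conditional product-Bernoulli probability. -/
theorem real_joint_le (hν : ∀ᵐ x ∂ν, x ∈ stdSimplex ℝ (Fin k))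
    {D : Set (U ⊕ T ⊕ R → Fin k → ℝ)} (hD : MeasurableSet D)
    {E : ((U × T) × R → Bool) → Set (U ⊕ T ⊕ R → Fin k → ℝ)} (hE : ∀ b, MeasurableSet (E b))
    {η : ℝ} (hη0 : 0 ≤ η) (hη : ∀ᵐ ω ∂μ, S.members ω ∈ D →
      bernProb (param P Pt (S.members ω)) {b | S.members ω ∈ E b} ≤ η) :
    μ.real {ω | S.members ω ∈ D ∧ S.members ω ∈ E (S.hit ω)} ≤ η := by
  have hset : {ω | S.members ω ∈ D ∧ S.members ω ∈ E (S.hit ω)}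
      ⊆ ⋃ b ∈ Finset.univ, S.members ⁻¹' (D ∩ E b) ∩ S.hit ⁻¹' {b} := by
    intro ω hω
    simpa using hω
  have hDE : ∀ b, MeasurableSet (S.members ⁻¹' (D ∩ E b)) := fun b =>
    S.measurable_members (hD.inter (hE b))
  have hint : ∀ b, Integrable ((S.members ⁻¹' (D ∩ E b)).indicator
      fun ω => bernMass (param P Pt (S.members ω)) b) μ := fun b =>
    (integrable_indicator_iff (hDE b)).2 (S.real_members_hit hν (hD.inter (hE b)) b).1
  calc μ.real {ω | S.members ω ∈ D ∧ S.members ω ∈ E (S.hit ω)}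
      ≤ ∑ b, μ.real (S.members ⁻¹' (D ∩ E b) ∩ S.hit ⁻¹' {b}) :=
        (measureReal_mono hset (measure_ne_top _ _)).trans (measureReal_biUnion_finset_le _ _)
    _ = ∑ b, ∫ ω, (S.members ⁻¹' (D ∩ E b)).indicator
          (fun ω => bernMass (param P Pt (S.members ω)) b) ω ∂μ := by
        refine Finset.sum_congr rfl fun b _ => ?_
        rw [(S.real_members_hit hν (hD.inter (hE b)) b).2, integral_indicator (hDE b)]
    _ = ∫ ω, ∑ b, (S.members ⁻¹' (D ∩ E b)).indicator
          (fun ω => bernMass (param P Pt (S.members ω)) b) ω ∂μ :=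
        (integral_finsetSum _ fun b _ => hint b).symm
    _ ≤ ∫ _, η ∂μ := by
        refine integral_mono_ae (integrable_finsetSum _ fun b _ => hint b) (integrable_const _) ?_
        filter_upwards [hη] with ω hω
        by_cases hωD : S.members ω ∈ D
        · refine le_trans (le_of_eq ?_) (hω hωD)
          simp only [bernProb, bernExp]
          refine Finset.sum_congr rfl fun b _ => ?_
          by_cases hb : S.members ω ∈ E b <;> simp [Set.indicator, hωD, hb]
        · refine le_trans (le_of_eq (Finset.sum_eq_zero fun b _ => ?_)) hη0
          simp [Set.indicator, hωD]
    _ = η := by simp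

/-- The exact moment is the Bernoulli parameter `param` of the memberships. -/
theorem expAdj_ae_eq (hν : ∀ᵐ x ∂ν, x ∈ stdSimplex ℝ (Fin k)) (hP : ∀ a c, 0 ≤ P a c)
    (hPt : ∀ a c, 0 ≤ Pt a c) (hP1 : ∀ a c, P a c ≤ 1) (hPt1 : ∀ a c, Pt a c ≤ 1) :
    ∀ᵐ ω ∂μ, ∀ ut r, S.expAdj ω ut r = param P Pt (S.members ω) (ut, r) := by
  refine ae_all_iff.2 fun ut => ae_all_iff.2 fun r => ?_
  have hadj : ∀ ω, S.adj ω ut r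
      = (S.hit ⁻¹' {b | b (ut, r) = true}).indicator (fun _ => (1 : ℝ)) ω := fun ω => by
    rw [adj_eq]
    simp [bmat, bval, Set.indicator]
  have hBm : MeasurableSet (S.hit ⁻¹' {b | b (ut, r) = true}) :=
    S.measurable_hit (Set.toFinite _).measurableSet
  have hpm : Measurable[S.sigmaMember] fun ω => param P Pt (S.members ω) (ut, r) :=
    (measurable_param (ut, r)).comp (comap_measurable S.members)
  have hpint : Integrable (fun ω => param P Pt (S.members ω) (ut, r)) μ := by
    refine Integrable.of_bound (hpm.mono S.sigmaMember_le le_rfl).aestronglyMeasurable 1 ?_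
    filter_upwards [S.ae_mem_stdSimplex hν] with ω hω
    rw [Real.norm_eq_abs, abs_of_nonneg (param_nonneg hω hP hPt _)]
    simpa using param_le hω hP hPt hP1 hPt1 (ut, r)
  have key : (fun ω => param P Pt (S.members ω) (ut, r))
      =ᵐ[μ] μ[fun ω' => S.adj ω' ut r | S.sigmaMember] := by
    refine ae_eq_condExp_of_forall_setIntegral_eq S.sigmaMember_le ?_
      (fun _ _ _ => hpint.integrableOn) ?_ hpm.stronglyMeasurable.aestronglyMeasurable
    · simp only [hadj]
      exact (integrable_const (1 : ℝ)).indicator hBm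
    · rintro _ ⟨D, hD, rfl⟩ -
      change ∫ ω in S.members ⁻¹' D, _ ∂μ = ∫ ω in S.members ⁻¹' D, _ ∂μ
      simp only [hadj]
      rw [setIntegral_indicator hBm]
      have h1 : ∀ ω, param P Pt (S.members ω) (ut, r)
          = ∑ b ∈ (Finset.univ.filter fun b : (U × T) × R → Bool => b (ut, r) = true),
            bernMass (param P Pt (S.members ω)) b := fun ω => by
        rw [← bernProb_coord (param P Pt (S.members ω)) (ut, r), Finset.sum_filter]
        simp [bernProb, bernExp, Set.indicator]
      simp only [h1]
      rw [integral_finsetSum _ fun b _ => (S.real_members_hit hν hD b).1]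
      have h2 := sum_measureReal_preimage_singleton (μ := μ.restrict (S.members ⁻¹' D))
        (f := S.hit) (Finset.univ.filter fun b : (U × T) × R → Bool => b (ut, r) = true)
        (fun b _ => S.measurable_hit (measurableSet_singleton b))
      simp only [integral_const, smul_eq_mul, mul_one, measureReal_restrict_apply,
        MeasurableSet.univ, Set.univ_inter]
      have h3 : S.hit ⁻¹' {b | b (ut, r) = true} = S.hit ⁻¹'
          ((Finset.univ.filter fun b : (U × T) × R → Bool => b (ut, r) = true : Finset _) :
            Set ((U × T) × R → Bool)) := by
        ext ω; simp
      rw [h3, Set.inter_comm, ← measureReal_restrict_apply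
        (S.measurable_hit (Finset.measurableSet _)), ← h2]
      refine Finset.sum_congr rfl fun b _ => ?_
      rw [← (S.real_members_hit hν hD b).2,
        measureReal_restrict_apply (S.measurable_hit (measurableSet_singleton b)), Set.inter_comm]
  filter_upwards [key] with ω hω
  simp only [expAdj, Matrix.of_apply]
  exact hω.symm

end Model

/-! ### Numerical bounds and the union of the exceptional events -/

section Assembly

/-- The separation requirement, combined with `σ_k(E[π πᵀ]) ≤ 1 / k`, bounds `p` from below. -/
lemma separation_sq_le {c ρ σ p q : ℝ} {k n : ℕ} (hc : 0 < c) (hk : 0 < k) (hn : 0 < n)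
    (hq : 0 ≤ q) (hqp : q < p) (hρ : 0 < ρ) (hρ1 : ρ ≤ 1) (hσ : 0 < σ) (hσk : σ ≤ 1 / k)
    (h : c * (√k / (√(n * ρ) * σ)) ≤ (p - q) ^ 2 / p) : c ^ 2 * k ^ 3 ≤ n * p ^ 2 := by
  have hp : 0 < p := hq.trans_lt hqp
  have hk' : (0 : ℝ) < k := by exact_mod_cast hk
  have hn' : (0 : ℝ) < n := by exact_mod_cast hn
  have h1 : (p - q) ^ 2 / p ≤ p := by
    rw [div_le_iff₀ hp]
    nlinarith
  have h2 : √(n * ρ) * σ ≤ √n / k := by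
    rw [div_eq_mul_one_div]
    refine mul_le_mul (Real.sqrt_le_sqrt ?_) hσk hσ.le (Real.sqrt_nonneg _)
    nlinarith
  have h3 : √k * k / √n ≤ √k / (√(n * ρ) * σ) := by
    rw [mul_div_assoc, div_eq_mul_inv (√(k : ℝ)), ← inv_div]
    have : 0 < √(n * ρ) * σ := by positivity
    gcongr
  have h4 : c * (√k * k) ≤ p * √n := by
    have h5 := (mul_le_mul_of_nonneg_left h3 hc.le).trans (h.trans h1)
    rw [← mul_div_assoc, div_le_iff₀ (by positivity)] at h5
    exact h5
  have h5 := pow_le_pow_left₀ (by positivity) h4 2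
  rw [mul_pow, mul_pow, mul_pow, Real.sq_sqrt hk'.le, Real.sq_sqrt hn'.le] at h5
  nlinarith

/-- The threshold on `p² log² (n / δ)` below which the incoherence of the singular vectors is
used. -/
noncomputable def threshold (c γ : ℝ) : ℝ :=
  min (1 / 8) (min (c ^ 2 * γ / 2000) (c ^ 4 * γ ^ 2 / 2560))

/-- The constant in the incoherence bound `Q i i ≤ cohConst c γ * p² log² (n / δ)`. -/
noncomputable def cohConst (c γ : ℝ) : ℝ :=
  1 / threshold c γ + 1 + 256 / (c ^ 2 * γ ^ 2) + 1280 / (c ^ 4 * γ ^ 2)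

lemma threshold_pos {c γ : ℝ} (hc : 0 < c) (hγ : 0 < γ) : 0 < threshold c γ := by
  unfold threshold; positivity

lemma cohConst_ge_one {c γ : ℝ} (hc : 0 < c) (hγ : 0 < γ) : 1 ≤ cohConst c γ := by
  have := threshold_pos hc hγ
  unfold cohConst
  have h1 : 0 ≤ 1 / threshold c γ := by positivity
  have h2 : 0 ≤ 256 / (c ^ 2 * γ ^ 2) := by positivity
  have h3 : 0 ≤ 1280 / (c ^ 4 * γ ^ 2) := by positivity
  linarith

/-- Bounds valid when `p² log² (n / δ)` is small; `N` stands for `|U| |T|`, `v` for `p²` and `L` for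
`log (n / δ)`. -/
lemma sparse_bounds {c γ v L k n N : ℝ} (hc : 0 < c) (hγ : 0 < γ) (hv : 0 < v) (hL : 1 ≤ L)
    (hk : 1 ≤ k) (hn : 0 < n) (hN : γ ^ 2 * n ^ 2 ≤ N) (hsep : c ^ 2 * k ^ 3 ≤ n * v)
    (hsmall : v * L ^ 2 ≤ threshold c γ) :
    v ≤ 1 / 8 ∧ 40 * k * L ≤ γ * n ∧ 256 * k ^ 3 * (10 * L) ≤ v * N ∧
      262144 * k ^ 6 * (10 * L) ≤ N ∧
      128 * k ^ 2 * (2 * v * n + 10 * L) ≤ cohConst c γ * v * L ^ 2 * (v * N) := by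
  have he1 : threshold c γ ≤ 1 / 8 := min_le_left _ _
  have he2 : threshold c γ ≤ c ^ 2 * γ / 2000 := (min_le_right _ _).trans (min_le_left _ _)
  have he3 : threshold c γ ≤ c ^ 4 * γ ^ 2 / 2560 := (min_le_right _ _).trans (min_le_right _ _)
  have hL2 : L ≤ L ^ 2 := by nlinarith
  have hk3 : 1 ≤ k ^ 3 := one_le_pow₀ hk
  have hk13 : k ≤ k ^ 3 := le_self_pow₀ hk (by norm_num)
  have hc2 : 0 < c ^ 2 := by positivity
  -- The quantity `k³ L²` is at most a small multiple of `n`.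
  have hkey : c ^ 2 * (k ^ 3 * L ^ 2) ≤ n * threshold c γ := by
    calc c ^ 2 * (k ^ 3 * L ^ 2) = c ^ 2 * k ^ 3 * L ^ 2 := by ring
      _ ≤ n * v * L ^ 2 := by gcongr
      _ = n * (v * L ^ 2) := by ring
      _ ≤ n * threshold c γ := by gcongr
  have hkey2 : 2000 * (k ^ 3 * L ^ 2) ≤ γ * n := by
    have : n * threshold c γ ≤ n * (c ^ 2 * γ / 2000) := by gcongr
    have : c ^ 2 * (2000 * (k ^ 3 * L ^ 2)) ≤ c ^ 2 * (γ * n) := by linarith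
    exact le_of_mul_le_mul_left this hc2
  have hkey3 : 2560 * (k ^ 3 * L ^ 2) ≤ c ^ 2 * γ ^ 2 * n := by
    have : n * threshold c γ ≤ n * (c ^ 4 * γ ^ 2 / 2560) := by gcongr
    have : c ^ 2 * (2560 * (k ^ 3 * L ^ 2)) ≤ c ^ 2 * (c ^ 2 * γ ^ 2 * n) := by nlinarith
    exact le_of_mul_le_mul_left this hc2
  have hL3 : L ≤ k ^ 3 * L ^ 2 := hL2.trans (le_mul_of_one_le_left (by positivity) hk3)
  have hvN : c ^ 2 * γ ^ 2 * k ^ 3 * n ≤ v * N := by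
    calc c ^ 2 * γ ^ 2 * k ^ 3 * n = γ ^ 2 * n * (c ^ 2 * k ^ 3) := by ring
      _ ≤ γ ^ 2 * n * (n * v) := by gcongr
      _ = v * (γ ^ 2 * n ^ 2) := by ring
      _ ≤ v * N := by gcongr
  refine ⟨?_, ?_, ?_, ?_, ?_⟩
  · have : v ≤ v * L ^ 2 := le_mul_of_one_le_right hv.le (one_le_pow₀ hL)
    linarith
  · have : k * L ≤ k ^ 3 * L ^ 2 := mul_le_mul hk13 hL2 (by linarith) (by positivity)
    nlinarith
  · refine le_trans ?_ hvN
    have h1 : 2560 * L ≤ c ^ 2 * γ ^ 2 * n := by linarith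
    have h2 := mul_le_mul_of_nonneg_left h1 (by positivity : 0 ≤ k ^ 3)
    linarith
  · refine le_trans ?_ hN
    have h1 := pow_le_pow_left₀ (by positivity) hkey2 2
    have h2 : L ≤ L ^ 4 := le_self_pow₀ hL (by norm_num)
    have h3 : k ^ 6 * L ≤ (k ^ 3 * L ^ 2) ^ 2 := by
      rw [mul_pow, ← pow_mul, ← pow_mul]
      gcongr
    nlinarith
  · have hkk : k ^ 2 ≤ k ^ 3 := pow_le_pow_right₀ hk (by norm_num)
    have h1 : 256 * k ^ 2 * (v * n) ≤ 256 / (c ^ 2 * γ ^ 2) * (v * L ^ 2 * (v * N)) := by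
      rw [div_mul_eq_mul_div, le_div_iff₀ (by positivity)]
      have h2 : k ^ 2 * (v * n) * (c ^ 2 * γ ^ 2) ≤ v * (v * N) := by
        calc k ^ 2 * (v * n) * (c ^ 2 * γ ^ 2) ≤ k ^ 3 * (v * n) * (c ^ 2 * γ ^ 2) := by gcongr
          _ = v * (c ^ 2 * γ ^ 2 * k ^ 3 * n) := by ring
          _ ≤ v * (v * N) := by gcongr
      have h3 : v * (v * N) ≤ v * L ^ 2 * (v * N) := by
        have h0 : 0 ≤ v * (v * N) := le_trans (by positivity) h2
        nlinarith [one_le_pow₀ hL (n := 2)]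
      linarith
    have h2 : 1280 * k ^ 2 * L ≤ 1280 / (c ^ 4 * γ ^ 2) * (v * L ^ 2 * (v * N)) := by
      rw [div_mul_eq_mul_div, le_div_iff₀ (by positivity)]
      have h3 : k ^ 2 * (c ^ 4 * γ ^ 2) ≤ v * (v * N) := by
        calc k ^ 2 * (c ^ 4 * γ ^ 2) ≤ (k ^ 3 * k ^ 3) * (c ^ 4 * γ ^ 2) := by
              have : k ^ 2 ≤ k ^ 3 * k ^ 3 := hkk.trans (le_mul_of_one_le_left (by positivity) hk3)
              gcongr
          _ = γ ^ 2 * ((c ^ 2 * k ^ 3) * (c ^ 2 * k ^ 3)) := by ring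
          _ ≤ γ ^ 2 * ((n * v) * (n * v)) := by gcongr
          _ = v * (v * (γ ^ 2 * n ^ 2)) := by ring
          _ ≤ v * (v * N) := by gcongr
      have h4 : L * (k ^ 2 * (c ^ 4 * γ ^ 2)) ≤ L ^ 2 * (v * (v * N)) :=
        mul_le_mul hL2 h3 (by positivity) (by positivity)
      linarith
    have h0 : 0 ≤ v * L ^ 2 * (v * N) := by
      have : 0 ≤ N := le_trans (by positivity) hN
      positivity
    have h3 := threshold_pos hc hγ
    have h4 : 0 ≤ (1 / threshold c γ + 1) * (v * L ^ 2 * (v * N)) := by positivity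
    have h5 : cohConst c γ * v * L ^ 2 * (v * N)
        = (1 / threshold c γ + 1) * (v * L ^ 2 * (v * N))
          + 256 / (c ^ 2 * γ ^ 2) * (v * L ^ 2 * (v * N))
          + 1280 / (c ^ 4 * γ ^ 2) * (v * L ^ 2 * (v * N)) := by
      unfold cohConst; ring
    linarith

/-- The sum of the probabilities of all exceptional events. There are at most `n ^ 5` of
them, and the level `10 log (n / δ)` makes each of them as rare as `δ / n ^ 5`. -/
lemma total_failure_le {k n r δ N : ℝ} (hn : 3 ≤ n) (hk0 : 0 ≤ k) (hk : k ≤ n)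
    (hr : r ≤ n) (hN0 : 0 ≤ N) (hN : N ≤ n ^ 2) (hδ : 0 < δ) (hδ1 : δ < 1) :
    2 * k * Real.exp (-(10 * Real.log (n / δ))) +
      ((N + 2 * k + 2 * k ^ 2) * Real.exp (-(10 * Real.log (n / δ)))
        + r * ((2 * N + 1) * Real.exp (-(10 * Real.log (n / δ))))) ≤ δ := by
  have hexp : Real.exp (-(10 * Real.log (n / δ))) ≤ δ / n ^ 5 := by
    have h1 : Real.exp (-(10 * Real.log (n / δ))) = (δ / n) ^ 10 := by
      rw [← Real.exp_log (show 0 < δ / n by positivity), ← Real.exp_nat_mul, ← inv_div n δ,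
        Real.log_inv]
      congr 1
      push_cast
      ring
    rw [h1, div_pow]
    have h2 : δ ^ 10 ≤ δ := pow_le_of_le_one hδ.le hδ1.le (by norm_num)
    have h3 : n ^ 5 ≤ n ^ 10 := pow_le_pow_right₀ (by linarith) (by norm_num)
    gcongr
  have hcount : 2 * k + (N + 2 * k + 2 * k ^ 2) + r * (2 * N + 1) ≤ n ^ 5 := by
    have h1 : k ^ 2 ≤ n ^ 2 := by gcongr
    have h2 : r * (2 * N + 1) ≤ n * (2 * n ^ 2 + 1) := by gcongr
    have h3 : 9 * n ^ 3 ≤ n ^ 5 := by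
      have h4 : 9 ≤ n ^ 2 := by nlinarith
      calc 9 * n ^ 3 ≤ n ^ 2 * n ^ 3 := by gcongr
        _ = n ^ 5 := by ring
    have h4 : 3 * n ≤ n ^ 2 := by nlinarith
    have h5 : 3 * n ^ 2 ≤ n ^ 3 := by nlinarith [sq_nonneg n]
    nlinarith
  calc _ = (2 * k + (N + 2 * k + 2 * k ^ 2) + r * (2 * N + 1))
        * Real.exp (-(10 * Real.log (n / δ))) := by ring
    _ ≤ n ^ 5 * (δ / n ^ 5) := by gcongr
    _ = δ := by field_simp

variable {J R : Type*} [Fintype J] [Fintype R] [DecidableEq J] [DecidableEq R]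

/-- The projection built from the columns in `Y`, as a function of the Boolean array. -/
def projOf (Y : Finset R) (Phat : Matrix J Y ℝ → Matrix J J ℝ) (b : J × R → Bool) :
    Matrix J J ℝ :=
  Phat ((bmat b).submatrix id fun y : Y => (y : R))

/-- Failure probability given the memberships: either the projection is coherent, or it is
incoherent and some column outside of `Y` has a large projection. -/
theorem bernProb_exists_projection_le {g : J × R → ℝ} (h0 : ∀ e, 0 ≤ g e) (h1 : ∀ e, g e ≤ 1)
    {k : ℕ} (hk : 0 < k) (Y : Finset R) {Phat : Matrix J Y ℝ → Matrix J J ℝ}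
    (hPhat : ∀ A, IsTopProjection k A (Phat A)) {v B : ℝ} (hg : ∀ e, g e ≤ v) (hB : 0 < B)
    (hvB : v ≤ B) {t : ℝ} (ht : 2 ≤ t) {η : ℝ}
    (hcoh : bernProb g {b | ∃ i, B < projOf Y Phat b i i} ≤ η) :
    bernProb g {b | ∃ x, x ∉ Y ∧
      k * v + 10 * t ^ 2 * B * √k < ∑ i, (projOf Y Phat b *ᵥ centredCol g x b) i ^ 2}
        ≤ η + Fintype.card R * ((2 * Fintype.card J + 1) * Real.exp (-t)) := by
  have hcols := bernProb_exists_le h0 h1 (fun x : R => if x ∈ Y then ∅ else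
    {b | (∀ j, projOf Y Phat b j j ≤ B) ∧
      k * v + 10 * t ^ 2 * B * √k < ∑ i, (projOf Y Phat b *ᵥ centredCol g x b) i ^ 2})
    (e := (2 * Fintype.card J + 1) * Real.exp (-t)) fun x => by
      split_ifs with hx
      · simp only [bernProb, bernExp, Set.indicator_empty, mul_zero, Finset.sum_const_zero]
        positivity
      · refine bernProb_projection_le h0 h1 (fun b i z => ?_)
          (fun b => (hPhat _).transpose_eq) (fun b => (hPhat _).mul_self) hk
          (fun b => (hPhat _).trace_eq) (fun i => hg _) hB hvB ht
        have : (bmat (Function.update b (i, x) z)).submatrix id (fun y : Y => (y : R))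
            = (bmat b).submatrix id (fun y : Y => (y : R)) := by
          ext j y
          simp only [bmat, Matrix.submatrix_apply, Matrix.of_apply]
          rw [Function.update_of_ne]
          intro h
          have h2 : (y : R) = x := (Prod.ext_iff.1 h).2
          exact hx (h2 ▸ y.2)
        rw [this]
  refine le_trans (bernProb_mono h0 h1 ?_)
    ((bernProb_union_le h0 h1 _ _).trans (add_le_add hcoh hcols))
  rintro b ⟨x, hx, hlt⟩
  by_cases hb : ∃ i, B < projOf Y Phat b i i
  · exact Or.inl hb
  · push Not at hb
    refine Or.inr ⟨x, ?_⟩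
    rw [if_neg hx]
    exact ⟨hb, hlt⟩

end Assembly

/-! ### The perturbation bound -/

section Combination

variable {Ω : Type*} [mΩ : MeasurableSpace Ω] {μ : Measure Ω} [IsProbabilityMeasure μ]
  {U T R : Type} [Fintype U] [Fintype T] [Fintype R] {k : ℕ} {ν : Measure (Fin k → ℝ)} {p q : ℝ}

/-- Outside of an event of small probability in the memberships, the projection is incoherent with
high conditional probability. When `p² log² (n / δ)` is not small this is trivial, since the
diagonal entries of a projection are at most one. -/
theorem exists_incoherent_event [DecidableEq U] [DecidableEq T] [DecidableEq R]
    (S : Model μ U T R k ν (homogeneous k p q) (homogeneous k p q))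
    (hν : ∀ᵐ x ∂ν, x ∈ stdSimplex ℝ (Fin k)) (hmean : ∀ i, ∫ x, x i ∂ν = 1 / k)
    (hq : 0 ≤ q) (hqp : q < p) (hp1 : p ≤ 1) {c γ L n : ℝ} (hc : 0 < c) (hγ : 0 < γ)
    (hL : 1 ≤ L) (hk : 0 < k) (hn : 0 < n) (hU : γ * n ≤ Fintype.card U)
    (hT : γ * n ≤ Fintype.card T) (hsep : c ^ 2 * k ^ 3 ≤ n * p ^ 2) (Y : Finset R)
    (hYn : Y.card ≤ n) (hkY : k ≤ Y.card) {Phat : Matrix (U × T) Y ℝ → Matrix (U × T) (U × T) ℝ}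
    (hPhat : ∀ A, IsTopProjection k A (Phat A)) :
    ∃ D : Set (U ⊕ T ⊕ R → Fin k → ℝ), MeasurableSet D ∧
      μ.real {ω | S.members ω ∉ D} ≤ 2 * k * Real.exp (-(10 * L)) ∧
      ∀ π ∈ D, (∀ i, π i ∈ stdSimplex ℝ (Fin k)) →
        bernProb (param (homogeneous k p q) (homogeneous k p q) π)
          {b | ∃ i, cohConst c γ * p ^ 2 * L ^ 2 < projOf Y Phat b i i}
        ≤ (Fintype.card (U × T) + 2 * k + 2 * k ^ 2) * Real.exp (-(10 * L)) := by
  have hp : 0 < p := hq.trans_lt hqp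
  have hv : 0 < p ^ 2 := by positivity
  have hth := threshold_pos hc hγ
  have hk1 : (1 : ℝ) ≤ k := by exact_mod_cast hk
  rcases lt_or_ge (threshold c γ) (p ^ 2 * L ^ 2) with hbig | hsmall
  · refine ⟨Set.univ, MeasurableSet.univ, by simp; positivity, fun π _ hπ => ?_⟩
    have hempty : {b : (U × T) × R → Bool |
        ∃ i, cohConst c γ * p ^ 2 * L ^ 2 < projOf Y Phat b i i} = ∅ := by
      ext b
      simp only [Set.mem_ofPred_eq, Set.mem_empty_iff_false, iff_false, not_exists, not_lt]
      intro i
      refine (proj_diag_le_one (hPhat _).transpose_eq (hPhat _).mul_self i).trans ?_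
      have h1 : 1 / threshold c γ ≤ cohConst c γ := by
        have h2 : 0 ≤ 256 / (c ^ 2 * γ ^ 2) := by positivity
        have h3 : 0 ≤ 1280 / (c ^ 4 * γ ^ 2) := by positivity
        unfold cohConst
        linarith
      calc (1 : ℝ) = 1 / threshold c γ * threshold c γ := by field_simp
        _ ≤ cohConst c γ * (p ^ 2 * L ^ 2) :=
          mul_le_mul h1 hbig.le hth.le (le_trans (by positivity) h1)
        _ = cohConst c γ * p ^ 2 * L ^ 2 := by ring
    rw [hempty]
    simp only [bernProb, bernExp, Set.indicator_empty, mul_zero, Finset.sum_const_zero]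
    positivity
  · have hcardN : (Fintype.card (U × T) : ℝ) = Fintype.card U * Fintype.card T := by
      rw [Fintype.card_prod]; push_cast; ring
    have hN : γ ^ 2 * n ^ 2 ≤ Fintype.card (U × T) := by
      rw [hcardN]
      calc γ ^ 2 * n ^ 2 = (γ * n) * (γ * n) := by ring
        _ ≤ _ := mul_le_mul hU hT (by positivity) (by positivity)
    obtain ⟨hv8, hmem, hdeg, hcross, hfin⟩ :=
      sparse_bounds hc hγ hv hL hk1 hn hN hsep hsmall
    have hN0 : (0 : ℝ) < Fintype.card (U × T) := lt_of_lt_of_le (by positivity) hN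
    have hkR : (0 : ℝ) < k := by linarith
    let D : Set (U ⊕ T ⊕ R → Fin k → ℝ) := {π | ∀ c,
      (Fintype.card U / (4 * k) : ℝ) < ∑ u, π (Sum.inl u) c ∧
      (Fintype.card T / (4 * k) : ℝ) < ∑ t, π (Sum.inr (Sum.inl t)) c}
    have hexp : ∀ m : ℝ, γ * n ≤ m → Real.exp (-(m / (4 * k))) ≤ Real.exp (-(10 * L)) :=
      fun m hm => by
        rw [Real.exp_le_exp, neg_le_neg_iff, le_div_iff₀ (by positivity)]
        linarith
    refine ⟨D, ?_, ?_, ?_⟩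
    · simp only [D, Set.ofPred_forall, Set.ofPred_and]
      exact .iInter fun c => (measurableSet_lt measurable_const (by fun_prop)).inter
        (measurableSet_lt measurable_const (by fun_prop))
    · have hsub : {ω | S.members ω ∉ D} ⊆
          (⋃ c ∈ (Finset.univ : Finset (Fin k)),
            {ω | ∑ u, S.members ω (Sum.inl u) c ≤ Fintype.card U / (4 * k)}) ∪
          ⋃ c ∈ (Finset.univ : Finset (Fin k)),
            {ω | ∑ t, S.members ω (Sum.inr (Sum.inl t)) c ≤ Fintype.card T / (4 * k)} := by
        intro ω hω
        simp only [D, Set.mem_ofPred_eq, not_forall, not_and_or, not_lt] at hω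
        obtain ⟨c, h | h⟩ := hω
        · exact Or.inl (Set.mem_biUnion (Finset.mem_univ c) h)
        · exact Or.inr (Set.mem_biUnion (Finset.mem_univ c) h)
      refine (measureReal_mono hsub (measure_ne_top _ _)).trans
        ((measureReal_union_le _ _).trans ?_)
      have hb : ∀ A : Fin k → Set Ω, (∀ c, μ.real (A c) ≤ Real.exp (-(10 * L))) →
          μ.real (⋃ c ∈ (Finset.univ : Finset (Fin k)), A c) ≤ k * Real.exp (-(10 * L)) :=
        fun A hA => by
          refine (measureReal_biUnion_finset_le _ _).trans
            ((Finset.sum_le_sum fun c _ => hA c).trans ?_)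
          simp
      have h1 := hb _ fun c => (S.real_sum_members_le hν hmean
        (f := fun u => Sum.inl u) Sum.inl_injective c).trans (hexp _ hU)
      have h2 := hb _ fun c => (S.real_sum_members_le hν hmean
        (f := fun t => Sum.inr (Sum.inl t)) (Sum.inr_injective.comp Sum.inl_injective) c).trans
          (hexp _ hT)
      linarith
    · intro π hπD hπ
      have hP0 := homogeneous_nonneg (k := k) hq hqp
      have hPp := homogeneous_le (k := k) hqp
      set N : ℝ := ((Fintype.card (U × T) : ℕ) : ℝ)
      set M : ℝ := p ^ 2 * N / (16 * k ^ 2) with hMdef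
      have hM : 0 < M := by positivity
      have hvN : 0 < p ^ 2 * N := by positivity
      have hkk : (k : ℝ) ^ 2 ≤ k ^ 3 := pow_le_pow_right₀ hk1 (by norm_num)
      have ht0 : 0 < 10 * L := by positivity
      -- The slope for inner products is chosen so that the first of the two terms in the bound for
      -- their fluctuations is exactly half of the admissible amount.
      have key := bernProb_coherent_le (param_nonneg hπ hP0 hP0) hv8
        (param_le hπ hP0 hP0 hPp hPp) Y hk hkY (Q := projOf Y Phat) (fun b => hPhat _)
        (M := M) (t := 10 * L) (lam := 256 * k ^ 3 * (10 * L) / (p ^ 2 * N))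
        (fun y _ => ?_) ht0.le (by positivity) ((div_le_one hvN).2 hdeg) ?_ ?_ ?_
      · refine le_trans (bernProb_mono (param_nonneg hπ hP0 hP0)
          (fun e => (param_le hπ hP0 hP0 hPp hPp e).trans (by nlinarith)) ?_) key
        rintro b ⟨i, hi⟩
        refine ⟨i, ?_⟩
        have h1 : 8 * (2 * p ^ 2 * Y.card + 10 * L) ≤ 8 * (2 * p ^ 2 * n + 10 * L) := by gcongr
        refine h1.trans_lt (lt_of_le_of_lt ?_ (mul_lt_mul_of_pos_left hi hM))
        rw [hMdef, div_mul_eq_mul_div, le_div_iff₀ (by positivity)]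
        linarith
      · refine le_trans (le_of_eq ?_) (le_sum_param hq hqp hπ (by positivity)
          (fun c => (hπD c).1.le) (by positivity) (fun c => (hπD c).2.le) y)
        rw [hMdef, hcardN]
        field_simp
        norm_num
      · rw [hMdef, le_div_iff₀ (by positivity)]
        nlinarith
      · have : (1 : ℝ) ≤ k ^ 3 := one_le_pow₀ hk1
        nlinarith
      · have e1 : k * (10 * L / (256 * k ^ 3 * (10 * L) / (p ^ 2 * N)))
            = p ^ 2 * N / (256 * k ^ 2) := by
          field_simp
        have e2 : k * (256 * k ^ 3 * (10 * L) / (p ^ 2 * N) * (4 * (p ^ 2) ^ 2 * N))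
            = 1024 * k ^ 4 * (10 * L) * p ^ 2 := by
          field_simp
          ring
        have e3 : 1024 * k ^ 4 * (10 * L) * p ^ 2 ≤ p ^ 2 * N / (256 * k ^ 2) := by
          rw [le_div_iff₀ (by positivity)]
          have := mul_le_mul_of_nonneg_left hcross hv.le
          linarith
        rw [mul_add, e1, e2]
        have e4 : M / 8 = p ^ 2 * N / (256 * k ^ 2) + p ^ 2 * N / (256 * k ^ 2) := by
          rw [hMdef]
          field_simp
          norm_num
        linarith

lemma measurableSet_projection_gt {J α : Type*} [Fintype J] [MeasurableSpace α]
    {g : α → J × R → ℝ} (hg : ∀ e, Measurable fun a => g a e) (Y : Finset R)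
    (Q : Matrix J J ℝ) (s : ℝ) (b : J × R → Bool) :
    MeasurableSet {a | ∃ x, x ∉ Y ∧ s < ∑ i, (Q *ᵥ centredCol (g a) x b) i ^ 2} := by
  simp only [Set.ofPred_exists]
  refine .iUnion fun x => ?_
  rw [Set.ofPred_and]
  refine (MeasurableSet.const _).inter (measurableSet_lt measurable_const ?_)
  simp only [Matrix.mulVec, dotProduct, centredCol]
  fun_prop

/-- The distance perturbation bound in terms of squares, with an explicit constant. -/
theorem real_large_projection_le [DecidableEq U] [DecidableEq T] [DecidableEq R]
    (S : Model μ U T R k ν (homogeneous k p q) (homogeneous k p q))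
    (hν : ∀ᵐ x ∂ν, x ∈ stdSimplex ℝ (Fin k)) (hmean : ∀ i, ∫ x, x i ∂ν = 1 / k)
    (hq : 0 ≤ q) (hqp : q < p) (hp1 : p ≤ 1) {c γ δ : ℝ} {n : ℕ} (hc : 0 < c) (hγ : 0 < γ)
    (hk : 0 < k) (hn3 : 3 ≤ n) (hn : n = Fintype.card U + Fintype.card T + Fintype.card R)
    (hU : γ * n ≤ Fintype.card U) (hT : γ * n ≤ Fintype.card T)
    (hsep : c ^ 2 * k ^ 3 ≤ n * p ^ 2) (Y : Finset R) (hkY : k ≤ Y.card)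
    {Phat : Matrix (U × T) Y ℝ → Matrix (U × T) (U × T) ℝ}
    (hPhat : ∀ A, IsTopProjection k A (Phat A)) (hδ : 0 < δ) (hδ1 : δ < 1) :
    μ.real {ω | ∃ x, x ∉ Y ∧
      k * p ^ 2 + 1000 * cohConst c γ * √k * p ^ 2 * Real.log (n / δ) ^ 4 <
        ∑ i, (Phat ((S.adj ω).submatrix id (fun y : Y => (y : R))) *ᵥ
          fun ut => S.adj ω ut x - S.expAdj ω ut x) i ^ 2} ≤ δ := by
  have hp : 0 < p := hq.trans_lt hqp
  have hn3' : (3 : ℝ) ≤ n := by exact_mod_cast hn3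
  have hP0 := homogeneous_nonneg (k := k) hq hqp
  have hPp := homogeneous_le (k := k) hqp
  have hL : 1 ≤ Real.log (n / δ) := by
    rw [Real.le_log_iff_exp_le (by positivity), le_div_iff₀ hδ]
    nlinarith [Real.exp_one_lt_d9, Real.exp_pos 1]
  set L := Real.log (n / δ)
  have hC := cohConst_ge_one hc hγ
  have hYR : Y.card ≤ Fintype.card R := Finset.card_le_univ Y
  have hYn : (Y.card : ℝ) ≤ n := by exact_mod_cast (by omega : Y.card ≤ n)
  have hkn : (k : ℝ) ≤ n := by exact_mod_cast (by omega : k ≤ n)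
  have hRn : (Fintype.card R : ℝ) ≤ n := by exact_mod_cast (by omega : Fintype.card R ≤ n)
  have hNn : (Fintype.card (U × T) : ℝ) ≤ n ^ 2 := by
    rw [Fintype.card_prod, sq]
    exact_mod_cast Nat.mul_le_mul (by omega) (by omega)
  obtain ⟨D, hD, hDprob, hDcoh⟩ := exists_incoherent_event S hν hmean hq hqp hp1 hc hγ hL hk
    (by linarith : (0 : ℝ) < n) hU hT hsep Y hYn hkY hPhat
  set B := cohConst c γ * p ^ 2 * L ^ 2 with hB
  have hvB : p ^ 2 ≤ B := by
    have h1 : 1 ≤ cohConst c γ * L ^ 2 := one_le_mul_of_one_le_of_one_le hC (one_le_pow₀ hL)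
    calc p ^ 2 ≤ p ^ 2 * (cohConst c γ * L ^ 2) := le_mul_of_one_le_right (by positivity) h1
      _ = B := by rw [hB]; ring
  have hB0 : 0 < B := lt_of_lt_of_le (by positivity) hvB
  let g : (U ⊕ T ⊕ R → Fin k → ℝ) → (U × T) × R → ℝ :=
    param (homogeneous k p q) (homogeneous k p q)
  let E : ((U × T) × R → Bool) → Set (U ⊕ T ⊕ R → Fin k → ℝ) := fun b => {π | ∃ x, x ∉ Y ∧
    k * p ^ 2 + 10 * (10 * L) ^ 2 * B * √k <
      ∑ i, (projOf Y Phat b *ᵥ centredCol (g π) x b) i ^ 2}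
  have hE : ∀ b, MeasurableSet (E b) := fun b =>
    measurableSet_projection_gt (g := g) (fun e => measurable_param e) Y _ _ b
  have hjoint := S.real_joint_le hν hD hE
    (η := (Fintype.card (U × T) + 2 * k + 2 * k ^ 2) * Real.exp (-(10 * L))
      + Fintype.card R * ((2 * Fintype.card (U × T) + 1) * Real.exp (-(10 * L))))
    (by positivity) (by
      filter_upwards [S.ae_mem_stdSimplex hν] with ω hω hωD
      have hpar := param_le hω hP0 hP0 hPp hPp
      exact bernProb_exists_projection_le (param_nonneg hω hP0 hP0)
        (fun e => (hpar e).trans (by nlinarith)) hk Y hPhat hpar hB0 hvB (by linarith)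
        (hDcoh _ hωD hω))
  have hae := S.expAdj_ae_eq hν hP0 hP0 (fun a c => (hPp a c).trans hp1)
    (fun a c => (hPp a c).trans hp1)
  have hnull : μ.real {ω | ¬ ∀ ut r, S.expAdj ω ut r = g (S.members ω) (ut, r)} = 0 := by
    rw [measureReal_def, ae_iff.1 hae, ENNReal.toReal_zero]
  have hlevel : 10 * (10 * L) ^ 2 * B * √k = 1000 * cohConst c γ * √k * p ^ 2 * L ^ 4 := by
    rw [hB]; ring
  refine (measureReal_mono (s₂ := {ω | ¬ ∀ ut r, S.expAdj ω ut r = g (S.members ω) (ut, r)} ∪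
    ({ω | S.members ω ∉ D} ∪ {ω | S.members ω ∈ D ∧ S.members ω ∈ E (S.hit ω)}))
    ?_ (measure_ne_top _ _)).trans ((measureReal_union_le _ _).trans
      ((add_le_add hnull.le ((measureReal_union_le _ _).trans
        (add_le_add hDprob hjoint))).trans ?_))
  · rintro ω ⟨x, hx, hlt⟩
    by_cases h1 : ∀ ut r, S.expAdj ω ut r = g (S.members ω) (ut, r)
    · by_cases h2 : S.members ω ∈ D
      · refine Or.inr (Or.inr ⟨h2, x, hx, ?_⟩)
        rw [hlevel]
        simp only [h1, S.adj_eq] at hlt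
        exact hlt
      · exact Or.inr (Or.inl h2)
    · exact Or.inl h1
  · rw [zero_add]
    exact total_failure_le hn3' (by positivity) hkn hRn (by positivity) hNn hδ hδ1

end Combination

end MMSF

theorem mainTheorem6 (c γ : ℝ) (hc : 0 < c) (hγ : 0 < γ) :
    ∃ C' : ℝ, 0 < C' ∧
      ∀ {Ω : Type*} [MeasurableSpace Ω] (μ : Measure Ω) [IsProbabilityMeasure μ]
        (U T R : Type) [Fintype U] [Fintype T] [Fintype R] (k n : ℕ)
        (ν : Measure (Fin k → ℝ)) [IsProbabilityMeasure ν] (p q : ℝ)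
        (S : MMSF.Model μ U T R k ν (MMSF.homogeneous k p q) (MMSF.homogeneous k p q))
        (Y : Finset R)
        (Phat : Matrix (U × T) Y ℝ → Matrix (U × T) (U × T) ℝ) (δ : ℝ),
        -- number of nodes, with users and tags making up a constant fraction of it
        n = Fintype.card U + Fintype.card T + Fintype.card R →
        γ * n ≤ Fintype.card U → γ * n ≤ Fintype.card T →
        -- membership law on the simplex, with equal expected community sizes
        (∀ᵐ x ∂ν, x ∈ stdSimplex ℝ (Fin k)) →
        (∀ i, ∫ x, x i ∂ν = 1 / k) →
        -- connectivity probabilities and the separation requirement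
        0 ≤ q → q < p → p ≤ 1 →
        0 < MMSF.pureProb ν → 0 < MMSF.sigmaMin (MMSF.secondMoment ν) →
        c * (√k / (√(n * MMSF.pureProb ν) * MMSF.sigmaMin (MMSF.secondMoment ν)))
          ≤ (p - q) ^ 2 / p →
        -- top-`k` left singular projection computed from the resources in `Y`
        k ≤ Y.card → (∀ A, MMSF.IsTopProjection k A (Phat A)) →
        0 < δ → δ < 1 →
        1 - δ ≤ μ.real {ω | ∀ x, x ∉ Y →
          ‖WithLp.toLp 2 (Phat ((S.adj ω).submatrix id (fun y : Y => (y : R))) *ᵥ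
              fun ut => S.adj ω ut x - S.expAdj ω ut x)‖
            ≤ √k * p * √(1 + C' / √k * (Real.log (n / δ)) ^ 4)} := by
  have hC := MMSF.cohConst_ge_one hc hγ
  refine ⟨1000 * MMSF.cohConst c γ, by linarith, ?_⟩
  intro Ω _ μ _ U T R _ _ _ k n ν _ p q S Y Phat δ hn hU hT hν hmean hq hqp hp1 hρ hσ hsep hkY
    hPhat hδ hδ1
  classical
  have hp : 0 < p := hq.trans_lt hqp
  -- The simplex in dimension zero is empty, so there is at least one community.
  have hk : 0 < k := by
    rcases Nat.eq_zero_or_pos k with rfl | h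
    · obtain ⟨x, hx⟩ := hν.exists
      simpa using hx.2
    · exact h
  have hR : 0 < Fintype.card R := lt_of_lt_of_le (hk.trans_le hkY) (Finset.card_le_univ Y)
  have hn0 : (0 : ℝ) < n := by exact_mod_cast (by omega : 0 < n)
  have hU0 : 0 < Fintype.card U := by exact_mod_cast (mul_pos hγ hn0).trans_le hU
  have hT0 : 0 < Fintype.card T := by exact_mod_cast (mul_pos hγ hn0).trans_le hT
  have hsq := MMSF.separation_sq_le hc hk (by omega) hq hqp hρ measureReal_le_one hσ
    (MMSF.sigmaMin_secondMoment_le hk hν hmean) hsep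
  have hbad := MMSF.real_large_projection_le S hν hmean hq hqp hp1 hc hγ hk (by omega) hn hU hT
    hsq Y hkY hPhat hδ hδ1
  set good := {ω | ∀ x, x ∉ Y →
    ‖WithLp.toLp 2 (Phat ((S.adj ω).submatrix id (fun y : Y => (y : R))) *ᵥ
      fun ut => S.adj ω ut x - S.expAdj ω ut x)‖
        ≤ √k * p * √(1 + 1000 * MMSF.cohConst c γ / √k * (Real.log (n / δ)) ^ 4)}
  have hcover : (Set.univ : Set Ω) ⊆ good ∪ {ω | ∃ x, x ∉ Y ∧
      k * p ^ 2 + 1000 * MMSF.cohConst c γ * √k * p ^ 2 * Real.log (n / δ) ^ 4 <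
        ∑ i, (Phat ((S.adj ω).submatrix id (fun y : Y => (y : R))) *ᵥ
          fun ut => S.adj ω ut x - S.expAdj ω ut x) i ^ 2} := by
    intro ω _
    by_contra hcon
    simp only [Set.mem_union, not_or, Set.mem_ofPred_eq, not_exists, not_and, not_lt] at hcon
    refine hcon.1 fun x hx => ?_
    rw [EuclideanSpace.norm_eq]
    refine Real.sqrt_le_iff.2 ⟨by positivity, ?_⟩
    have hk' : (0 : ℝ) < k := by exact_mod_cast hk
    have hs : √(k : ℝ) ^ 2 = k := Real.sq_sqrt hk'.le
    have hs0 : √(k : ℝ) ≠ 0 := by positivity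
    have hid : (√k * p * √(1 + 1000 * MMSF.cohConst c γ / √k * Real.log (n / δ) ^ 4)) ^ 2
        = k * p ^ 2 + 1000 * MMSF.cohConst c γ * √k * p ^ 2 * Real.log (n / δ) ^ 4 := by
      rw [mul_pow, mul_pow, hs, Real.sq_sqrt (by positivity)]
      have : (k : ℝ) / √k = √k := by rw [div_eq_iff hs0, ← sq, hs]
      calc (k : ℝ) * p ^ 2 * (1 + 1000 * MMSF.cohConst c γ / √k * Real.log (n / δ) ^ 4)
          = k * p ^ 2 + 1000 * MMSF.cohConst c γ * (k / √k) * p ^ 2 * Real.log (n / δ) ^ 4 := by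
            ring
        _ = _ := by rw [this]
    rw [hid]
    simpa only [Real.norm_eq_abs, sq_abs] using hcon.2 x hx
  have h1 := (measureReal_mono (μ := μ) hcover (measure_ne_top _ _)).trans
    (measureReal_union_le _ _)
  rw [probReal_univ] at h1
  linarith
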